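/- Let $M\subset\mathbb R^n$ be a smooth (embedded) submanifold of codimension $p$, with the metric induced from the Euclidean scalar product. Superforms. On $\mathbb R^n_s=\mathbb R^n_x\oplus\mathbb R^n_\xi$ a superform is $a=\sum a_{I,J}(x)\,dx_I\wedge d\xi_J$; it has bidegree $(r,s)$ if $|I|=r$, $|J|=s$ in all terms. Put $J(dx_i)=d\xi_i$, $J(d\xi_i)=-dx_i$, $J(a\wedge b)=J(a)\wedge J(b)$, and $a^\#=J(a)$ for $(1,0)$-forms $a$; $a$ is symmetric if $J(a)=a$. Let $da=\sum_k dx_k\wedge\partial a/\partial x_k$ and $d^\#a=\sum_k d\xi_k\wedge\partial a/\partial x_k$. A form on $M_s$ is a family of exterior forms on $T_xM\oplus T_xM$, $x\in M$, and it is smooth if it is locally the restriction to $M_s$ of a smooth superform. Contraction $\rfloor$ is the adjoint of exterior multiplication; on $M_s$ it is taken with respect to the scalar product of $T_xM$. For $v\in T_xM$, $v^\#\rfloor$ denotes contraction with $(0,v)$. Every point of $M$ has an open neighbourhood $U$ with smooth functions $\rho_1,\dots,\rho_p$ on $U$ such that $M\cap U=\{\rho_1=\dots=\rho_p=0\}$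 and the forms $n_j=d\rho_j$ are orthonormal on $M\cap U$. For such functions let $F_j=d(n_j^\#)$, $\mathcal F^\#=\sum_jF_j\wedge(n_j\rfloor\,\cdot\,)$ and $D^\#=d^\#+\mathcal F^\#$. Then: (i) $D^\#$ is well defined on smooth forms on $M_s$: the restriction of $D^\#\alpha$ to $M_s$ depends only on the restriction of $\alpha$ to $M_s$, and not on the choice of the $\rho_j$. It maps smooth forms of bidegree $(r,s)$ on $M_s$ to smooth forms of bidegree $(r,s+1)$. (ii) $D^\#$ is the Levi-Civita connection $\nabla$ of $M$: with vectors and $(1,0)$-forms identified by the metric, $\nabla_v a=v^\#\rfloor D^\#a$ is the Levi-Civita connection on the tangent bundle, and for every $r$ and every smooth $(r,0)$-form $a$ on $M_s$, $v^\#\rfloor D^\#a$ is the covariant derivative of $a$ induced by it, i.e. for smooth tangent vector fields $X_1,\dots,X_r$ $$(v^\#\rfloor D^\#a)(X_1,\dots,X_r)=v\big(a(X_1,\dots,X_r)\big)-\sum_i a(X_1,\dots,\nabla_vX_i,\dots,X_r).$$ (iii) The curvature of $M$ is given by the restriction to $M_s$ of $R=\frac12\sum_jF_j\wedge F_j$.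 This is a globally well defined smooth symmetric form of bidegree $(2,2)$ on $M_s$, and $$(D^\#)^2a=a\rfloor R\quad\text{on } M_s$$ for all smooth $(1,0)$-forms $a$ on $M_s$. Moreover (Gauss's formula), for smooth tangent vector fields $V,W,X,Y$, $$R\big((X,0),(Y,0),(0,V),(0,W)\big)=\big\langle\nabla_V\nabla_WX-\nabla_W\nabla_VX-\nabla_{[V,W]}X,\;Y\big\rangle .$$ -/

import Mathlib

open scoped ContDiff Gradient

noncomputable section

namespace Super

/-! ### Linear superalgebra

`V × V` is the superspace `V_s = V_0 ⊕ V_1` of `V`: the first factor carries the variable `x`, the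
second one the variable `ξ`. -/

section Linear

variable {V W : Type*}
variable [NormedAddCommGroup V] [NormedSpace ℝ V] [NormedAddCommGroup W] [NormedSpace ℝ W]

/-- Exterior forms of total degree `k` on the superspace of `V`. -/
abbrev SForm (V : Type*) [NormedAddCommGroup V] [NormedSpace ℝ V] (k : ℕ) : Type _ :=
  (V × V) [⋀^Fin k]→L[ℝ] ℝ

/-- The `1`-form given by a linear functional. -/
def oneForm (φ : (V × V) →L[ℝ] ℝ) : SForm V 1 :=
  ContinuousAlternatingMap.ofSubsingleton ℝ (V × V) ℝ (0 : Fin 1) φ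

/-- The linear functional given by a `1`-form. -/
def oneFormDual (a : SForm V 1) : (V × V) →L[ℝ] ℝ :=
  (ContinuousAlternatingMap.ofSubsingleton ℝ (V × V) ℝ (0 : Fin 1)).symm a

/-- `(v₁, …, v_{p+q}) ↦ a (v₁, …, v_p) * b (v_{p+1}, …, v_{p+q})`. -/
def mulForms {p q : ℕ} (a : SForm V p) (b : SForm V q) :
    ContinuousMultilinearMap ℝ (fun _ : Fin (p + q) => V × V) ℝ :=
  { ((LinearMap.mul' ℝ ℝ).compMultilinearMap
      (MultilinearMap.domCoprod a.toMultilinearMap b.toMultilinearMap)).domDomCongr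
        finSumFinEquiv with
    cont := by
      change Continuous fun v : Fin (p + q) → V × V =>
        a (fun i => v (Fin.castAdd q i)) * b (fun i => v (Fin.natAdd p i))
      exact (a.cont.comp (by fun_prop)).mul (b.cont.comp (by fun_prop)) }

theorem mulForms_apply {p q : ℕ} (a : SForm V p) (b : SForm V q) (v : Fin (p + q) → V × V) :
    mulForms a b v = a (fun i => v (Fin.castAdd q i)) * b (fun i => v (Fin.natAdd p i)) := rfl

/-- The wedge product, `a ∧ b = (1 / (p! q!)) ∑_σ sign σ • (a ⊗ b) ∘ σ`. -/
def wedge {p q : ℕ} (a : SForm V p) (b : SForm V q) : SForm V (p + q) :=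
  ((p.factorial : ℝ) * (q.factorial : ℝ))⁻¹ •
    ContinuousMultilinearMap.alternatization (mulForms a b)

/-- A form of degree `k`, regarded as a form of the equal degree `l`. -/
def castDegree {k l : ℕ} (h : k = l) (a : SForm V k) : SForm V l := h ▸ a

/-- The operator `F ⊗ v⌋`: first contract with the vector `v`, then wedge with the `2`-form `F`
(contraction of a form of degree `0` is `0`). -/
def contractThenWedge (F : SForm V 2) (v : V × V) : (k : ℕ) → SForm V k → SForm V (k + 1)
  | 0, _ => 0
  | k + 1, a => castDegree (Nat.add_comm 2 k) (wedge F (a.curryLeft v))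

/-- The form `a` has bidegree `(p, q)`, i.e. `a = ∑_{|I| = p, |J| = q} a_{I,J} dx_I ∧ dξ_J`:
evaluated on vectors each of which lies in `V_0` or in `V_1`, it vanishes unless exactly `p` of the
vectors lie in `V_0`. -/
def HasBidegree {k : ℕ} (p q : ℕ) (a : SForm V k) : Prop :=
  p + q = k ∧ ∀ (s : Finset (Fin k)) (v : Fin k → V), s.card ≠ p →
    a (fun i => if i ∈ s then (v i, 0) else (0, v i)) = 0

/-- The complex structure on forms: `J (dx_i) = dξ_i`, `J (dξ_i) = - dx_i` and
`J (a ∧ b) = J a ∧ J b`, that is, the pull-back by `(x, ξ) ↦ (ξ, -x)`. -/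
def J {k : ℕ} (a : SForm V k) : SForm V k :=
  a.compContinuousLinearMap
    ((ContinuousLinearMap.snd ℝ V V).prod (-(ContinuousLinearMap.fst ℝ V V)))

/-- A form is symmetric if `J a = a`, i.e. `a_{I,J} = a_{J,I}` if `a` has bidegree `(p, p)`. -/
def IsSymmetric {k : ℕ} (a : SForm V k) : Prop := J a = a

end Linear

section Euclidean

variable {V : Type*} [NormedAddCommGroup V] [InnerProductSpace ℝ V]

/-- The vector of `V` that corresponds to the `(1,0)`-part of a `1`-form through the scalar
product: `⟪sharp a, w⟫ = a (w, 0)`. -/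
def sharp [FiniteDimensional ℝ V] (a : SForm V 1) : V :=
  haveI : CompleteSpace V := FiniteDimensional.complete ℝ V
  (InnerProductSpace.toDual ℝ V).symm ((oneFormDual a).comp (ContinuousLinearMap.inl ℝ V V))

/-- The `(1,0)`-form that corresponds to a vector: `flat v (x, ξ) = ⟪v, x⟫`. -/
def flat (v : V) : SForm V 1 :=
  oneForm ((innerSL ℝ v).comp (ContinuousLinearMap.fst ℝ V V))

/-- The contraction `a ⌋ R` of a form `R` with a `(1,0)`-form `a`. -/
def contract [FiniteDimensional ℝ V] {k : ℕ} (a : SForm V 1) (R : SForm V (k + 1)) : SForm V k :=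
  R.curryLeft (sharp a, 0)

end Euclidean

/-! ### Superforms on `ℝⁿ` -/

/-- Euclidean space `ℝⁿ`. -/
abbrev Euc (n : ℕ) : Type := EuclideanSpace ℝ (Fin n)

/-- Superforms of total degree `k`, i.e. `∑ a_{I,J}(x) dx_I ∧ dξ_J` with `|I| + |J| = k`: the
coefficients depend on `x` only. -/
abbrev Superform (n k : ℕ) : Type := Euc n → SForm (Euc n) k

variable {n : ℕ}

/-- `d a = ∑_k dx_k ∧ ∂a/∂x_k`. -/
def d {k : ℕ} (a : Superform n k) : Superform n (k + 1) := fun x =>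
  ContinuousAlternatingMap.alternatizeUncurryFin
    ((fderiv ℝ a x).comp (ContinuousLinearMap.fst ℝ (Euc n) (Euc n)))

/-- `d^# a = ∑_k dξ_k ∧ ∂a/∂x_k`. -/
def dSharp {k : ℕ} (a : Superform n k) : Superform n (k + 1) := fun x =>
  ContinuousAlternatingMap.alternatizeUncurryFin
    ((fderiv ℝ a x).comp (ContinuousLinearMap.snd ℝ (Euc n) (Euc n)))

/-- The `(1,0)`-form `dρ = ∑_i (∂ρ/∂x_i) dx_i` of a function `ρ`. -/
def normalForm (ρ : Euc n → ℝ) : Superform n 1 := fun x =>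
  oneForm ((fderiv ℝ ρ x).comp (ContinuousLinearMap.fst ℝ (Euc n) (Euc n)))

/-- The `(1,1)`-form `F = d ν^#`, where `ν = dρ` and `ν^# = J ν`. -/
def secondForm (ρ : Euc n → ℝ) : Superform n 2 :=
  d (k := 1) (fun x => J (normalForm ρ x))

/-! ### Submanifolds -/

/-- `M` is a smooth (embedded) submanifold of `ℝⁿ` of codimension `p`: locally it is the zero set
of `p` smooth functions, whose differentials are linearly independent on `M`. -/
def IsSubmanifold (p : ℕ) (M : Set (Euc n)) : Prop :=
  ∀ x ∈ M, ∃ U : Set (Euc n), IsOpen U ∧ x ∈ U ∧ ∃ ρ : Fin p → Euc n → ℝ,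
    (∀ j, ContDiffOn ℝ ∞ (ρ j) U) ∧ M ∩ U = {y ∈ U | ∀ j, ρ j y = 0} ∧
      ∀ y ∈ M ∩ U, LinearIndependent ℝ (fun j => ∇ (ρ j) y)

/-- Local defining functions `ρ_1, …, ρ_p` of `M` on an open set `U`, normalized so that the normal
forms `ν_j = dρ_j` are orthonormal on `M`. -/
structure NormalSystem (p : ℕ) (M : Set (Euc n)) where
  /-- the open set where the functions are defined -/
  U : Set (Euc n)
  /-- the defining functions -/
  ρ : Fin p → Euc n → ℝ
  isOpen_U : IsOpen U
  smooth : ∀ j, ContDiffOn ℝ ∞ (ρ j) U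
  inter_eq : M ∩ U = {y ∈ U | ∀ j, ρ j y = 0}
  orthonormal : ∀ y ∈ M ∩ U, Orthonormal ℝ (fun j => ∇ (ρ j) y)

namespace NormalSystem

variable {p : ℕ} {M : Set (Euc n)}

/-- The operator `𝓕^# = ∑_j F_j ⊗ ν_j⌋`. -/
def FSharp (S : NormalSystem p M) {k : ℕ} (a : Superform n k) : Superform n (k + 1) := fun x =>
  ∑ j, contractThenWedge (secondForm (S.ρ j) x) (∇ (S.ρ j) x, 0) k (a x)

/-- The operator `D^# = d^# + 𝓕^#`. -/
def DSharp (S : NormalSystem p M) {k : ℕ} (a : Superform n k) : Superform n (k + 1) := fun x =>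
  dSharp a x + S.FSharp a x

/-- The form `(1/2) ∑_j F_j ∧ F_j`. -/
def curvatureForm (S : NormalSystem p M) : Superform n 4 := fun x =>
  (1 / 2 : ℝ) • ∑ j, wedge (secondForm (S.ρ j) x) (secondForm (S.ρ j) x)

end NormalSystem

/-- The tangent space `T_x M`. -/
def T (M : Set (Euc n)) (x : M) : Submodule ℝ (Euc n) :=
  Submodule.span ℝ (tangentConeAt ℝ M (x : Euc n))

/-- The inclusion of the superspace of `T_x M` in the superspace of `ℝⁿ`. -/
def superIncl (M : Set (Euc n)) (x : M) : (T M x × T M x) →L[ℝ] (Euc n × Euc n) :=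
  (T M x).subtypeL.prodMap (T M x).subtypeL

/-- Forms of total degree `k` on the superspace `M_s` of `M`. -/
abbrev SuperformOn (M : Set (Euc n)) (k : ℕ) : Type :=
  (x : M) → SForm (T M x) k

/-- The restriction to `M_s` of a superform on the ambient space. -/
def restrict (M : Set (Euc n)) {k : ℕ} (α : Superform n k) : SuperformOn M k := fun x =>
  (α x).compContinuousLinearMap (superIncl M x)

/-- `α` is, on the open set `U`, a smooth extension of the form `a` on `M_s`. -/
def IsExtension {M : Set (Euc n)} {k : ℕ} (a : SuperformOn M k) (U : Set (Euc n))
    (α : Superform n k) : Prop :=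
  ContDiffOn ℝ ∞ α U ∧ ∀ x : M, (x : Euc n) ∈ U → a x = restrict M α x

/-- A form on `M_s` is smooth if it locally has smooth extensions to the ambient space. -/
def IsSmoothForm {M : Set (Euc n)} {k : ℕ} (a : SuperformOn M k) : Prop :=
  ∀ x : M, ∃ U : Set (Euc n), IsOpen U ∧ (x : Euc n) ∈ U ∧ ∃ α, IsExtension a U α

open Classical in
/-- The operator `D^#` on forms on `M_s`: near a point of `M`, extend the form to the ambient space,
apply `d^# + 𝓕^#`, formed with some normalized local defining functions, and restrict to `M_s`.
(The value is `0` where there is no extension.) -/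
def DSharpOn (p : ℕ) {M : Set (Euc n)} {k : ℕ} (a : SuperformOn M k) : SuperformOn M (k + 1) :=
  fun x =>
    if h : ∃ A : NormalSystem p M × Superform n k, (x : Euc n) ∈ A.1.U ∧ IsExtension a A.1.U A.2
    then restrict M (h.choose.1.DSharp h.choose.2) x
    else 0

/-! ### Riemannian geometry of a submanifold, with the induced metric -/

/-- A map on `M` is smooth if it locally extends to a smooth map on the ambient space. -/
def IsSmoothMap {M : Set (Euc n)} {G : Type*} [NormedAddCommGroup G] [NormedSpace ℝ G]
    (f : M → G) : Prop :=
  ∀ x : M, ∃ U : Set (Euc n), IsOpen U ∧ (x : Euc n) ∈ U ∧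
    ∃ g : Euc n → G, ContDiffOn ℝ ∞ g U ∧ ∀ y : M, (y : Euc n) ∈ U → f y = g y

/-- The derivative at `x` of a map on `M`, as a linear map on `T_x M`. -/
def derivOn {M : Set (Euc n)} {G : Type*} [NormedAddCommGroup G] [NormedSpace ℝ G]
    (f : M → G) (x : M) : T M x →L[ℝ] G :=
  (fderivWithin ℝ (Function.extend Subtype.val f 0) M x).comp (T M x).subtypeL

/-- Vector fields on `M`. -/
abbrev VField (M : Set (Euc n)) : Type := (x : M) → T M x

/-- A vector field as a map to the ambient space. -/
def VField.val {M : Set (Euc n)} (X : VField M) : M → Euc n := fun x => (X x : Euc n)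

/-- Smooth vector fields. -/
def VField.IsSmooth {M : Set (Euc n)} (X : VField M) : Prop := IsSmoothMap X.val

/-- The Lie bracket `[X, Y]` of vector fields on `M`, as a map to the ambient space. -/
def ambientBracket {M : Set (Euc n)} (X Y : VField M) : M → Euc n := fun x =>
  derivOn Y.val x (X x) - derivOn X.val x (Y x)

/-- The Lie bracket `[X, Y]` as a vector field on `M`. (It is tangent to `M` when `X` and `Y` are
smooth, and then the orthogonal projection on `T_x M` does not change it.) -/
def bracket {M : Set (Euc n)} (X Y : VField M) : VField M := fun x =>
  (T M x).orthogonalProjectionOnto (ambientBracket X Y x)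

/-- `C X x v = ∇_v X (x)` is the Levi-Civita connection of `M`: it is a smooth connection on the
tangent bundle, compatible with the metric, and without torsion. -/
structure IsLeviCivita (M : Set (Euc n)) (C : VField M → (x : M) → T M x → T M x) : Prop where
  smooth : ∀ X Y : VField M, X.IsSmooth → Y.IsSmooth →
    VField.IsSmooth (fun x => C Y x (X x))
  add_vector : ∀ Y : VField M, Y.IsSmooth → ∀ (x : M) (v w : T M x),
    C Y x (v + w) = C Y x v + C Y x w
  smul_vector : ∀ Y : VField M, Y.IsSmooth → ∀ (x : M) (c : ℝ) (v : T M x),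
    C Y x (c • v) = c • C Y x v
  add_field : ∀ Y Z : VField M, Y.IsSmooth → Z.IsSmooth → ∀ (x : M) (v : T M x),
    C (Y + Z) x v = C Y x v + C Z x v
  leibniz : ∀ (f : M → ℝ) (Y : VField M), IsSmoothMap f → Y.IsSmooth → ∀ (x : M) (v : T M x),
    C (fun y => f y • Y y) x v = f x • C Y x v + derivOn f x v • Y x
  metric : ∀ Y Z : VField M, Y.IsSmooth → Z.IsSmooth → ∀ (x : M) (v : T M x),
    derivOn (fun y => inner ℝ (Y y) (Z y)) x v = inner ℝ (C Y x v) (Z x) + inner ℝ (Y x) (C Z x v)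
  torsion_free : ∀ X Y : VField M, X.IsSmooth → Y.IsSmooth → ∀ x : M,
    ((C Y x (X x) - C X x (Y x) : T M x) : Euc n) = ambientBracket X Y x

/-- The curvature `∇_V ∇_W X - ∇_W ∇_V X - ∇_{[V, W]} X` of a connection. -/
def riemann {M : Set (Euc n)} (C : VField M → (x : M) → T M x → T M x) (V W X : VField M) :
    VField M := fun x =>
  C (fun y => C X y (W y)) x (V x) - C (fun y => C X y (V y)) x (W x) - C X x (bracket V W x)

/-- The connection on the tangent bundle of `M` that is defined by `D^#`: the vector `∇_v X`
corresponds, under the identification of vectors and `(1,0)`-forms by the metric, to `v^# ⌋ D^# a`,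
where `a` is the `(1,0)`-form that corresponds to `X`. -/
def connection (p : ℕ) (M : Set (Euc n)) : VField M → (x : M) → T M x → T M x := fun X x v =>
  sharp ((DSharpOn p (k := 1) (fun y => flat (X y)) x).curryLeft (0, v))

end Super

end

noncomputable section

namespace Super

open Filter Topology

/-! ### Wedge product with a `2`-form as a sum over pairs of positions. -/

section

/-! Let `Π = S.proj`, i.e. `v ↦ v - ∑ ⟪n_j, v⟫ n_j`. On `M` it is the orthogonal projection on the
tangent space, hence independent of the defining functions. For a superform `α` let `Π^*α` be the
form `S.pull α`. The proof rests on the identity `D^#α = d^#(Π^*α)` after restriction to `M_s`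
(`restrict_DSharp`). By the product rule `d^#(Π^*α)` consists of `d^#α` and of terms containing the
derivative of `Π`. For tangent `u`, `v` this derivative is `-∑ Hess ρ_j(u, v) n_j`
(`fderiv_proj_of_mem`); antisymmetrized over two arguments it becomes `∑ F_j n_j`
(`fderiv_superProj_sub`), so the extra terms are exactly `∑ F_j ∧ (n_j ⌋ α)`.

On `M` the form `Π^*α` depends only on the restriction of `α`, and the restriction of `d^#` involves
only tangential derivatives, which see only values on `M` (`fderiv_eq_of_eventuallyEq_on`). Hence
`D^#` is well defined, and `d^#(Π^*α)` is itself a smooth extension of `D^#a`.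

If `g` extends a tangent field `X`, the same identity gives `∇_v X = Π(dg v)`, the classical
description of the Levi-Civita connection; for `(r,0)`-forms it reduces the covariant derivative to
the product rule.

For the curvature, put `β = Π^*(flat g)`. Since `(d^#)² = 0`, `(D^#)²a` is the restriction of `∑ F_j
∧ (n_j ⌋ d^#β)`. Differentiating `⟪n_j, g⟫ = 0` along `M` gives `n_j ⌋ d^#β = Hess ρ_j(X, ·)` in the
`ξ`-variable, which equals `X ⌋ F_j` on `M_s`; the sum is `X ⌋ R`. The form `R` is global because
orthonormality of the `n_j` turns `∑ F_j F_j` into scalar products of derivatives of `Π`. Gauss's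
formula follows by expanding `∇∇X` with `∇ = Π ∘ d`: the derivative of the outer `Π` leaves products
of Hessians, and the other terms cancel. -/

open Equiv Equiv.Perm in
-- A permutation of `n + 1` positions is the choice of the image `i` of `0` followed by a
-- permutation of the rest; the cycle moving `0` to `i` has sign `(-1)^i`.
theorem sum_perm_succ {n : ℕ} {E : Type*} (G : (Fin (n + 1) → E) → ℝ) (v : Fin (n + 1) → E) :
    ∑ σ : Perm (Fin (n + 1)), ((sign σ : ℤ) : ℝ) * G (v ∘ σ) =
      ∑ i : Fin (n + 1), (-1 : ℝ) ^ (i : ℕ) *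
        ∑ τ : Perm (Fin n), ((sign τ : ℤ) : ℝ) * G (Fin.cons (v i) (i.removeNth v ∘ τ)) := by
  classical
  set Φ : Fin (n + 1) × Perm (Fin n) → Perm (Fin (n + 1)) := fun x =>
    x.1.cycleRange.symm * decomposeFin.symm (0, x.2) with hΦ
  have h0 : ∀ x, Φ x 0 = x.1 := fun x => by
    simp [hΦ, decomposeFin_symm_apply_zero, Fin.cycleRange_symm_zero]
  have hs : ∀ x m, Φ x (Fin.succ m) = x.1.succAbove (x.2 m) := fun x m => by
    simp [hΦ, decomposeFin_symm_apply_succ, Fin.cycleRange_symm_succ]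
  have hinj : Function.Injective Φ := by
    rintro ⟨i, τ⟩ ⟨i', τ'⟩ h
    obtain rfl : i = i' := by simpa [h0] using congrArg (fun σ => σ 0) h
    congr 1
    ext m
    have := hs (i, τ) m
    rw [h, hs] at this
    rw [i.succAbove_right_injective this]
  have hbij : Function.Bijective Φ := by
    rw [Fintype.bijective_iff_injective_and_card]
    refine ⟨hinj, ?_⟩
    simp [Fintype.card_perm, Nat.factorial_succ]
  rw [← (Equiv.ofBijective Φ hbij).sum_comp, Fintype.sum_prod_type]
  refine Finset.sum_congr rfl fun i _ => ?_
  rw [Finset.mul_sum]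
  refine Finset.sum_congr rfl fun τ _ => ?_
  have hsign : ((sign (Φ (i, τ)) : ℤ) : ℝ) = (-1) ^ (i : ℕ) * ((sign τ : ℤ) : ℝ) := by
    simp [hΦ, Fin.sign_cycleRange, decomposeFin.symm_sign]
  have hv : v ∘ Φ (i, τ) = Fin.cons (v i) (i.removeNth v ∘ τ) := by
    funext m
    refine Fin.cases ?_ (fun m => ?_) m
    · simp [h0]
    · simp [hs, Fin.removeNth]
  simp only [Equiv.ofBijective_apply, hsign, hv, mul_assoc]

section

variable {V : Type*} [NormedAddCommGroup V] [NormedSpace ℝ V]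

theorem castDegree_apply {k l : ℕ} (h : k = l) (a : SForm V k) (v : Fin l → V × V) :
    castDegree h a v = a (fun i => v (Fin.cast h i)) := by
  subst h; rfl

theorem sum_perm_form {k : ℕ} (b : SForm V k) (v : Fin k → V × V) :
    ∑ σ : Equiv.Perm (Fin k), ((Equiv.Perm.sign σ : ℤ) : ℝ) * b (v ∘ σ) = k.factorial * b v := by
  have : ∀ σ : Equiv.Perm (Fin k), ((Equiv.Perm.sign σ : ℤ) : ℝ) * b (v ∘ σ) = b v := by
    intro σ
    have h := b.toAlternatingMap.map_perm v σ
    have h' : b (v ∘ σ) = (Equiv.Perm.sign σ : ℤˣ) • b v := h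
    rw [h', Units.smul_def, zsmul_eq_mul, ← mul_assoc, ← Int.cast_mul]
    simp
  simp [this, Fintype.card_perm]

/-- The bilinear map `(u, w) ↦ F (u, w) • b` with values in forms. -/
def bilinOfForm {q : ℕ} (F : SForm V 2) (b : SForm V q) :
    (V × V) →L[ℝ] (V × V) →L[ℝ] SForm V q :=
  ((ContinuousLinearMap.smulRightL ℝ (V × V) (SForm V q)).flip b).comp
    (((ContinuousAlternatingMap.ofSubsingletonLIE (𝕜 := ℝ) (E := V × V) (F := ℝ)
      (i := (0 : Fin 1))).symm.toContinuousLinearEquiv :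
      SForm V 1 →L[ℝ] ((V × V) →L[ℝ] ℝ)).comp F.curryLeft)

theorem bilinOfForm_apply {q : ℕ} (F : SForm V 2) (b : SForm V q) (u w : V × V) :
    bilinOfForm F b u w = F ![u, w] • b := by
  have h : (fun _ : Fin 1 => w) = ![w] := by ext i <;> simp
  change F (Matrix.vecCons u fun _ : Fin 1 => w) • b = _
  rw [h]

/-- The arguments of `F` sit at positions `i.castSucc < j.succ`, so `j ≥ i` lists every pair once.
Antisymmetry of `F` merges the two orders of a pair; the resulting `2` and the `q!` from permuting
the arguments of `b` cancel the normalization of `wedge`. -/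
theorem castDegree_wedge_two_apply {q : ℕ} (F : SForm V 2) (b : SForm V q)
    (v : Fin (q + 2) → V × V) :
    castDegree (Nat.add_comm 2 q) (wedge F b) v =
      ∑ i : Fin (q + 1), ∑ j ≥ i, (-1 : ℝ) ^ (i + j : ℕ) *
        (F ![v i.castSucc, v j.succ] * b (j.removeNth (i.castSucc.removeNth v))) := by
  have hF : ∀ u w, F ![u, w] = - F ![w, u] := fun u w => by
    have := F.toAlternatingMap.map_swap ![w, u] (i := 0) (j := 1) (by simp)
    have h : ![w, u] ∘ Equiv.swap (0 : Fin 2) 1 = ![u, w] := by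
      ext i <;> fin_cases i <;> rfl
    rw [h] at this
    exact this
  set G : (Fin (q + 2) → V × V) → ℝ := fun v => F ![v 0, v 1] * b (fun m => v m.succ.succ) with hG
  have hcast : castDegree (Nat.add_comm 2 q) (wedge F b) v = (2 * (q.factorial : ℝ))⁻¹ *
      ∑ σ : Equiv.Perm (Fin (q + 2)), ((Equiv.Perm.sign σ : ℤ) : ℝ) * G (v ∘ σ) := by
    rw [castDegree_apply, wedge]
    simp only [ContinuousAlternatingMap.smul_apply,
      ContinuousMultilinearMap.alternatization_apply_apply, mulForms_apply, smul_eq_mul]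
    congr 1
    rw [← (finCongr (Nat.add_comm 2 q)).permCongr.sum_comp]
    refine Finset.sum_congr rfl fun σ _ => ?_
    rw [Equiv.Perm.sign_permCongr, Units.smul_def, zsmul_eq_mul]
    congr 1
    simp only [hG, Function.comp]
    congr 2
    · ext i <;> fin_cases i <;> simp <;> rfl
    · funext i
      have h : Fin.cast (Nat.add_comm 2 q).symm i.succ.succ = Fin.natAdd 2 i := by
        ext; simp; omega
      simp [h]
  have hq : (q.factorial : ℝ) ≠ 0 := by positivity
  -- Peeling off two positions one after the other is a twofold `alternatizeUncurryFin` of the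
  -- bilinear map `bilinOfForm F b`.
  have h2 : ∑ σ : Equiv.Perm (Fin (q + 2)), ((Equiv.Perm.sign σ : ℤ) : ℝ) * G (v ∘ σ) =
      q.factorial * ContinuousAlternatingMap.alternatizeUncurryFin
        (ContinuousAlternatingMap.alternatizeUncurryFinCLM ℝ (V × V) ℝ ∘L bilinOfForm F b) v := by
    rw [sum_perm_succ, ContinuousAlternatingMap.alternatizeUncurryFin_apply, Finset.mul_sum]
    refine Finset.sum_congr rfl fun i _ => ?_
    have := sum_perm_succ (fun w => G (Fin.cons (v i) w)) (i.removeNth v)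
    rw [this]
    simp only [ContinuousLinearMap.comp_apply,
      ContinuousAlternatingMap.alternatizeUncurryFinCLM_apply,
      ContinuousAlternatingMap.alternatizeUncurryFin_apply, bilinOfForm_apply]
    have hj : ∀ j : Fin (q + 1), ∑ τ : Equiv.Perm (Fin q), ((Equiv.Perm.sign τ : ℤ) : ℝ) *
        G (Fin.cons (v i) (Fin.cons (i.removeNth v j) (j.removeNth (i.removeNth v) ∘ τ))) =
        q.factorial * (F ![v i, i.removeNth v j] * b (j.removeNth (i.removeNth v))) := fun j => by
      rw [mul_left_comm, ← sum_perm_form, Finset.mul_sum]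
      refine Finset.sum_congr rfl fun τ _ => ?_
      rw [mul_left_comm]
      rfl
    simp only [hj, zsmul_eq_mul, ContinuousAlternatingMap.smul_apply, smul_eq_mul, Finset.mul_sum,
      Int.cast_pow, Int.cast_neg, Int.cast_one]
    refine Finset.sum_congr rfl fun j _ => ?_
    ring
  rw [hcast, h2, ContinuousAlternatingMap.alternatizeUncurryFin_alternatizeUncurryFinCLM_comp_apply]
  rw [mul_inv, mul_assoc, inv_mul_cancel_left₀ hq, Finset.mul_sum]
  refine Finset.sum_congr rfl fun i _ => ?_
  rw [Finset.mul_sum]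
  refine Finset.sum_congr rfl fun j _ => ?_
  simp only [bilinOfForm_apply, ContinuousAlternatingMap.smul_apply, smul_eq_mul, zsmul_eq_mul,
    hF (v j.succ) (v i.castSucc), Int.cast_pow, Int.cast_neg, Int.cast_one]
  ring

end

end

/-! ### Explicit alternating sums, and calculus of form-valued maps. -/

section

section

variable {V : Type*} [NormedAddCommGroup V] [NormedSpace ℝ V]

theorem wedge_self_apply (F : SForm V 2) (a b c e : V × V) :
    wedge F F ![a, b, c, e] =
      2 * (F ![a, b] * F ![c, e] - F ![a, c] * F ![b, e] + F ![a, e] * F ![b, c]) := by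
  have h : wedge F F ![a, b, c, e] = ∑ i : Fin 3, ∑ j ∈ Finset.Ici i, (-1 : ℝ) ^ (i + j : ℕ) *
      (F ![![a, b, c, e] i.castSucc, ![a, b, c, e] j.succ] *
        F (j.removeNth (i.castSucc.removeNth ![a, b, c, e]))) :=
    castDegree_wedge_two_apply F F ![a, b, c, e]
  rw [h]
  have hI0 : Finset.Ici (0 : Fin 3) = {0, 1, 2} := by decide
  have hI1 : Finset.Ici (1 : Fin 3) = {1, 2} := by decide
  have hI2 : Finset.Ici (2 : Fin 3) = {2} := by decide
  have e00 : (0 : Fin 3).removeNth ((Fin.castSucc (0 : Fin 3)).removeNth ![a, b, c, e]) =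
      ![c, e] := by
    funext i; fin_cases i <;> rfl
  have e01 : (1 : Fin 3).removeNth ((Fin.castSucc (0 : Fin 3)).removeNth ![a, b, c, e]) =
      ![b, e] := by
    funext i; fin_cases i <;> rfl
  have e02 : (2 : Fin 3).removeNth ((Fin.castSucc (0 : Fin 3)).removeNth ![a, b, c, e]) =
      ![b, c] := by
    funext i; fin_cases i <;> rfl
  have e11 : (1 : Fin 3).removeNth ((Fin.castSucc (1 : Fin 3)).removeNth ![a, b, c, e]) =
      ![a, e] := by
    funext i; fin_cases i <;> rfl
  have e12 : (2 : Fin 3).removeNth ((Fin.castSucc (1 : Fin 3)).removeNth ![a, b, c, e]) =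
      ![a, c] := by
    funext i; fin_cases i <;> rfl
  have e22 : (2 : Fin 3).removeNth ((Fin.castSucc (2 : Fin 3)).removeNth ![a, b, c, e]) =
      ![a, b] := by
    funext i; fin_cases i <;> rfl
  have a0 : ![a, b, c, e] (Fin.castSucc (0 : Fin 3)) = a := rfl
  have a1 : ![a, b, c, e] (Fin.castSucc (1 : Fin 3)) = b := rfl
  have a2 : ![a, b, c, e] (Fin.castSucc (2 : Fin 3)) = c := rfl
  have b0 : ![a, b, c, e] (Fin.succ (0 : Fin 3)) = b := rfl
  have b1 : ![a, b, c, e] (Fin.succ (1 : Fin 3)) = c := rfl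
  have b2 : ![a, b, c, e] (Fin.succ (2 : Fin 3)) = e := rfl
  simp only [Fin.sum_univ_three, hI0, hI1, hI2]
  rw [Finset.sum_insert (by decide), Finset.sum_pair (by decide), Finset.sum_pair (by decide),
    Finset.sum_singleton]
  simp only [e00, e01, e02, e11, e12, e22, a0, a1, a2, b0, b1, b2]
  norm_num
  ring

theorem contractThenWedge_succ_apply {k : ℕ} (F : SForm V 2) (N : V × V) (a : SForm V (k + 1))
    (v : Fin (k + 2) → V × V) :
    contractThenWedge F N (k + 1) a v =
      ∑ i : Fin (k + 1), ∑ j ≥ i, (-1 : ℝ) ^ (i + j : ℕ) *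
        (F ![v i.castSucc, v j.succ] *
          a (Matrix.vecCons N (j.removeNth (i.castSucc.removeNth v)))) :=
  castDegree_wedge_two_apply F (a.curryLeft N) v

/-- This is the extra term in `d^#` of a pull-back by a varying linear map, where `h` is the
variation of that map. The sum has the shape of `contractThenWedge_succ_apply`, with the
antisymmetrization of `h` in place of `F` times the contracting vector. -/
theorem alternatizeUncurryFin_fderivComp_apply {k : ℕ} (a : SForm V (k + 1))
    (Q : (V × V) →L[ℝ] (V × V)) (h : (V × V) →L[ℝ] (V × V) →L[ℝ] (V × V))
    (v : Fin (k + 2) → V × V) (hv : ∀ i, Q (v i) = v i) :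
    ContinuousAlternatingMap.alternatizeUncurryFin (a.fderivCompContinuousLinearMap Q ∘L h) v =
      ∑ i : Fin (k + 1), ∑ j ≥ i, (-1 : ℝ) ^ (i + j : ℕ) *
        a (Matrix.vecCons (h (v i.castSucc) (v j.succ) - h (v j.succ) (v i.castSucc))
          (j.removeNth (i.castSucc.removeNth v))) := by
  rw [ContinuousAlternatingMap.fderivCompContinuousLinearMap_eq_alternatizeUncurryFin,
    ContinuousLinearMap.comp_assoc,
    ContinuousAlternatingMap.alternatizeUncurryFin_alternatizeUncurryFinCLM_comp_apply]
  refine Finset.sum_congr rfl fun i _ => Finset.sum_congr rfl fun j _ => ?_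
  rw [zsmul_eq_mul]
  push_cast
  congr 1
  have hQ : ∀ u : V × V, (a.curryLeft u).compContinuousLinearMap Q
      (j.removeNth (i.castSucc.removeNth v)) =
      a.curryLeft u (j.removeNth (i.castSucc.removeNth v)) := fun u => by
    rw [ContinuousAlternatingMap.compContinuousLinearMap_apply]
    congr 1
    funext m
    exact hv _
  change (a.curryLeft (h (v i.castSucc) (v j.succ))).compContinuousLinearMap Q _ -
    (a.curryLeft (h (v j.succ) (v i.castSucc))).compContinuousLinearMap Q _ = _
  rw [hQ, hQ]
  change _ = a.curryLeft (_ - _) _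
  rw [map_sub]
  rfl

end

section

variable {E V : Type*} [NormedAddCommGroup E] [NormedSpace ℝ E]
  [NormedAddCommGroup V] [NormedSpace ℝ V] {k : ℕ}

theorem contDiffOn_form_apply {β : E → SForm V k} {U : Set E}
    (hβ : ContDiffOn ℝ ∞ β U) {g : Fin k → E → V × V} (hg : ∀ i, ContDiffOn ℝ ∞ (g i) U) :
    ContDiffOn ℝ ∞ (fun y => β y (fun i => g i y)) U := by
  have h : ContDiff ℝ ∞ (fun p : SForm V k × (Fin k → V × V) => p.1 p.2) := by
    rw [contDiff_iff_contDiffAt]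
    intro p
    exact AnalyticAt.contDiffAt (ContinuousLinearMap.analyticAt_uncurry_of_multilinear
      (ContinuousAlternatingMap.toContinuousMultilinearMapCLM ℝ (E := V × V) (F := ℝ)
        (ι := Fin k) (𝕜 := ℝ)))
  exact h.comp_contDiffOn (hβ.prodMk (contDiffOn_pi.2 hg))

/-- The values on tuples of basis vectors determine a form linearly and injectively, and a linear
left inverse recovers the form from them. -/
theorem contDiffOn_form_iff [FiniteDimensional ℝ V] {β : E → SForm V k} {U : Set E} :
    ContDiffOn ℝ ∞ β U ↔ ∀ v, ContDiffOn ℝ ∞ (fun y => β y v) U := by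
  refine ⟨fun h v => contDiffOn_form_apply h fun _ => contDiffOn_const, fun h => ?_⟩
  let e := Module.finBasis ℝ (V × V)
  let L : SForm V k →ₗ[ℝ] ((Fin k → Fin (Module.finrank ℝ (V × V))) → ℝ) :=
    { toFun := fun a I => a (fun i => e (I i))
      map_add' := fun _ _ => rfl
      map_smul' := fun _ _ => rfl }
  have hL : LinearMap.ker L = ⊥ := by
    rw [LinearMap.ker_eq_bot]
    intro a b hab
    apply ContinuousAlternatingMap.toContinuousMultilinearMap_injective
    apply ContinuousMultilinearMap.toMultilinearMap_injective
    exact Module.Basis.ext_multilinear (fun _ => e) fun I => congrFun hab I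
  obtain ⟨g, hg⟩ := L.exists_leftInverse_of_injective hL
  have : β = fun y => g.toContinuousLinearMap (fun I => β y (fun i => e (I i))) := by
    funext y
    exact (LinearMap.congr_fun hg (β y)).symm
  rw [this]
  exact g.toContinuousLinearMap.contDiff.comp_contDiffOn (contDiffOn_pi.2 fun I => h _)

theorem fderiv_form_apply {β : E → SForm V k} {x : E} (h : DifferentiableAt ℝ β x) (u : E)
    (v : Fin k → V × V) : fderiv ℝ β x u v = fderiv ℝ (fun y => β y v) x u := by
  have := ((ContinuousAlternatingMap.apply ℝ (V × V) ℝ v).hasFDerivAt.comp x h.hasFDerivAt).fderiv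
  change fderiv ℝ (fun y => β y v) x = _ at this
  rw [this]; rfl

end

end

/-! ### Hessians, tangential derivatives and the tangent space. -/

section

theorem fderiv_fderiv_comm {E F : Type*} [NormedAddCommGroup E] [NormedSpace ℝ E]
    [NormedAddCommGroup F] [NormedSpace ℝ F] {f : E → F} {U : Set E} (hU : IsOpen U)
    (hf : ContDiffOn ℝ ∞ f U) {x : E} (hx : x ∈ U) (u v : E) :
    fderiv ℝ (fderiv ℝ f) x u v = fderiv ℝ (fderiv ℝ f) x v u :=
  (hf.contDiffAt (hU.mem_nhds hx)).isSymmSndFDerivAt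
    (by simpa using WithTop.coe_le_coe.2 (le_top (a := (2 : ℕ∞)))) u v

theorem contDiffOn_fderiv_apply {E F : Type*} [NormedAddCommGroup E] [NormedSpace ℝ E]
    [NormedAddCommGroup F] [NormedSpace ℝ F] {f : E → F}
    {U : Set E} (hU : IsOpen U) (hf : ContDiffOn ℝ ∞ f U) {g : E → E} (hg : ContDiffOn ℝ ∞ g U) :
    ContDiffOn ℝ ∞ (fun y => fderiv ℝ f y (g y)) U :=
  (hf.fderiv_of_isOpen hU (by simp)).clm_apply hg

theorem differentiableAt_of_contDiffOn {E F : Type*} [NormedAddCommGroup E] [NormedSpace ℝ E]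
    [NormedAddCommGroup F] [NormedSpace ℝ F]
    {f : E → F} {U : Set E} (hU : IsOpen U) (hf : ContDiffOn ℝ ∞ f U) {x : E} (hx : x ∈ U) :
    DifferentiableAt ℝ f x :=
  (hf.contDiffAt (hU.mem_nhds hx)).differentiableAt (by simp)

section

variable {E : Type*} [NormedAddCommGroup E] [InnerProductSpace ℝ E] [CompleteSpace E]

theorem inner_gradient_eq_fderiv (f : E → ℝ) (x v : E) : inner ℝ (∇ f x) v = fderiv ℝ f x v := by
  rw [← toDual_gradient, InnerProductSpace.toDual_apply_apply]

theorem contDiffOn_gradient {f : E → ℝ} {U : Set E} (hU : IsOpen U) (hf : ContDiffOn ℝ ∞ f U) :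
    ContDiffOn ℝ ∞ (∇ f) U :=
  (InnerProductSpace.toDual ℝ E).symm.toContinuousLinearEquiv.contDiff.comp_contDiffOn
    (hf.fderiv_of_isOpen hU (by simp))

theorem inner_fderiv_gradient {f : E → ℝ} {U : Set E} (hU : IsOpen U) (hf : ContDiffOn ℝ ∞ f U)
    {x : E} (hx : x ∈ U) (u v : E) :
    inner ℝ (fderiv ℝ (∇ f) x u) v = fderiv ℝ (fderiv ℝ f) x u v := by
  have hd : DifferentiableAt ℝ (fderiv ℝ f) x :=
    differentiableAt_of_contDiffOn hU (hf.fderiv_of_isOpen hU (by simp)) hx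
  have h := ((InnerProductSpace.toDual ℝ E).symm.toContinuousLinearEquiv.toContinuousLinearMap
    |>.hasFDerivAt.comp x hd.hasFDerivAt).fderiv
  change fderiv ℝ (∇ f) x = _ at h
  rw [h]
  exact InnerProductSpace.toDual_symm_apply

end

variable {n : ℕ}

theorem J_normalForm_apply (ρ : Euc n → ℝ) (y : Euc n) (v : Fin 1 → Euc n × Euc n) :
    J (normalForm ρ y) v = fderiv ℝ ρ y (v 0).2 := rfl

theorem contDiffOn_J_normalForm {ρ : Euc n → ℝ} {U : Set (Euc n)} (hU : IsOpen U)
    (hρ : ContDiffOn ℝ ∞ ρ U) : ContDiffOn ℝ ∞ (fun y => J (normalForm ρ y)) U :=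
  contDiffOn_form_iff.2 fun _ => contDiffOn_fderiv_apply hU hρ contDiffOn_const

theorem secondForm_apply {ρ : Euc n → ℝ} {U : Set (Euc n)} (hU : IsOpen U)
    (hρ : ContDiffOn ℝ ∞ ρ U) {x : Euc n} (hx : x ∈ U) (v : Fin 2 → Euc n × Euc n) :
    secondForm ρ x v = fderiv ℝ (fderiv ℝ ρ) x (v 0).1 (v 1).2 -
      fderiv ℝ (fderiv ℝ ρ) x (v 1).1 (v 0).2 := by
  have hβ := differentiableAt_of_contDiffOn hU (contDiffOn_J_normalForm hU hρ) hx
  have hd : DifferentiableAt ℝ (fderiv ℝ ρ) x :=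
    differentiableAt_of_contDiffOn hU (hρ.fderiv_of_isOpen hU (by simp)) hx
  have key : ∀ (u : Euc n) (w : Fin 1 → Euc n × Euc n),
      fderiv ℝ (fun y => J (normalForm ρ y)) x u w = fderiv ℝ (fderiv ℝ ρ) x u (w 0).2 := by
    intro u w
    rw [fderiv_form_apply hβ]
    simp only [J_normalForm_apply]
    rw [fderiv_clm_apply hd (by fun_prop)]
    simp
  rw [secondForm, d, ContinuousAlternatingMap.alternatizeUncurryFin_apply, Fin.sum_univ_two]
  simp only [ContinuousLinearMap.comp_apply, key, ContinuousLinearMap.coe_fst']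
  simp [Fin.removeNth, sub_eq_add_neg]

theorem contDiffOn_secondForm {ρ : Euc n → ℝ} {U : Set (Euc n)} (hU : IsOpen U)
    (hρ : ContDiffOn ℝ ∞ ρ U) : ContDiffOn ℝ ∞ (secondForm ρ) U := by
  refine contDiffOn_form_iff.2 fun v => ?_
  have h := hρ.fderiv_of_isOpen hU (m := ∞) (by simp)
  exact (((contDiffOn_fderiv_apply hU h (contDiffOn_const (c := (v 0).1))).clm_apply
    (contDiffOn_const (c := (v 1).2))).sub ((contDiffOn_fderiv_apply hU h
    (contDiffOn_const (c := (v 1).1))).clm_apply (contDiffOn_const (c := (v 0).2)))).congr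
    fun y hy => secondForm_apply hU hρ hy v

variable {M : Set (Euc n)} {p : ℕ}

/-- Derivatives within `M` are unique on the tangent cone, hence on its span. This is why no choice
of extension matters. -/
theorem fderiv_eq_of_eventuallyEq_on {G : Type*} [NormedAddCommGroup G] [NormedSpace ℝ G]
    {g h : Euc n → G} {x : M} (hg : DifferentiableAt ℝ g x) (hh : DifferentiableAt ℝ h x)
    {W : Set (Euc n)} (hW : IsOpen W) (hx : (x : Euc n) ∈ W) (heq : ∀ y ∈ M ∩ W, g y = h y)
    {v : Euc n} (hv : v ∈ T M x) : fderiv ℝ g x v = fderiv ℝ h x v := by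
  have hev : h =ᶠ[𝓝[M] (x : Euc n)] g := by
    filter_upwards [inter_mem_nhdsWithin M (hW.mem_nhds hx)] with y hy using (heq y hy).symm
  have h1 : HasFDerivWithinAt g (fderiv ℝ g x) M x := hg.hasFDerivAt.hasFDerivWithinAt
  have h2 : HasFDerivWithinAt g (fderiv ℝ h x) M x :=
    hh.hasFDerivAt.hasFDerivWithinAt.congr_of_eventuallyEq hev.symm
      (hev.symm.self_of_nhdsWithin x.2)
  have hE := h1.unique_on h2
  have hle : T M x ≤ LinearMap.eqLocus (fderiv ℝ g x : Euc n →ₗ[ℝ] G) (fderiv ℝ h x) :=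
    Submodule.span_le.2 fun w hw => hE hw
  exact hle hv

/-- The value `0` given to the map off `M`, and the arbitrariness of `fderivWithin` off the tangent
directions, are both harmless: on `T M x` any differentiable extension gives the derivative. -/
theorem derivOn_apply {G : Type*} [NormedAddCommGroup G] [NormedSpace ℝ G]
    {f : M → G} {g : Euc n → G} {x : M} (hg : DifferentiableAt ℝ g x)
    {W : Set (Euc n)} (hW : IsOpen W) (hx : (x : Euc n) ∈ W)
    (heq : ∀ y : M, (y : Euc n) ∈ W → f y = g y) (v : T M x) :
    derivOn f x v = fderiv ℝ g x v := by
  set F := Function.extend Subtype.val f 0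
  have hF : ∀ y ∈ M ∩ W, F y = g y := fun y hy => by
    rw [← heq ⟨y, hy.1⟩ hy.2]
    exact Subtype.val_injective.extend_apply f 0 ⟨y, hy.1⟩
  have hev : F =ᶠ[𝓝[M] (x : Euc n)] g := by
    filter_upwards [inter_mem_nhdsWithin M (hW.mem_nhds hx)] with y hy using hF y hy
  have h1 : HasFDerivWithinAt F (fderiv ℝ g x) M x :=
    hg.hasFDerivAt.hasFDerivWithinAt.congr_of_eventuallyEq hev (hF x ⟨x.2, hx⟩)
  have hE := h1.differentiableWithinAt.hasFDerivWithinAt.unique_on h1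
  have hle : T M x ≤ LinearMap.eqLocus (fderivWithin ℝ F M x : Euc n →ₗ[ℝ] G) (fderiv ℝ g x) :=
    Submodule.span_le.2 fun w hw => hE hw
  exact hle v.2

theorem mem_tangentConeAt_of_hasDerivAt {E : Type*} [NormedAddCommGroup E] [NormedSpace ℝ E]
    {s : Set E} {c : ℝ → E} {v : E} (hc : HasDerivAt c v 0) (hs : ∀ᶠ t in 𝓝 0, c t ∈ s) :
    v ∈ tangentConeAt ℝ s (c 0) := by
  have h := hasDerivAt_iff_tendsto_slope_zero.1 hc
  simp only [zero_add] at h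
  refine mem_tangentConeAt_of_seq (𝓝[≠] (0 : ℝ)) (fun t => t⁻¹) (fun t => c t - c 0) ?_ ?_ h
  · have := hc.continuousAt.tendsto.sub_const (c 0)
    rw [sub_self] at this
    exact this.mono_left nhdsWithin_le_nhds
  · filter_upwards [nhdsWithin_le_nhds hs] with t ht
    simpa using ht

/-- Tangential derivatives of the `ρ_j` vanish because `ρ_j = 0` on `M`. Conversely, the implicit
function theorem provides a curve in `M` through `x` with any given velocity annihilated by all
`dρ_j`. -/
theorem mem_T_iff (S : NormalSystem p M) {x : M} (hx : (x : Euc n) ∈ S.U) {v : Euc n} :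
    v ∈ T M x ↔ ∀ j, inner ℝ (∇ (S.ρ j) x) v = 0 := by
  have hd : ∀ j, DifferentiableAt ℝ (S.ρ j) x := fun j =>
    differentiableAt_of_contDiffOn S.isOpen_U (S.smooth j) hx
  have hzero : ∀ y ∈ M ∩ S.U, ∀ j, S.ρ j y = 0 := fun y hy => by
    rw [S.inter_eq] at hy
    exact hy.2
  simp only [inner_gradient_eq_fderiv]
  refine ⟨fun hv j => ?_, fun hv => ?_⟩
  · rw [fderiv_eq_of_eventuallyEq_on (h := fun _ => (0 : ℝ)) (hd j)
      (differentiableAt_const _) S.isOpen_U hx (fun y hy => hzero y hy j) hv]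
    simp
  · apply Submodule.subset_span
    set f : Euc n → (Fin p → ℝ) := fun y j => S.ρ j y
    set f' : Euc n →L[ℝ] (Fin p → ℝ) := ContinuousLinearMap.pi fun j => fderiv ℝ (S.ρ j) x
    have hf : HasStrictFDerivAt f f' (x : Euc n) := hasStrictFDerivAt_pi.2 fun j =>
      ((S.smooth j).contDiffAt (S.isOpen_U.mem_nhds hx)).hasStrictFDerivAt (by simp)
    have hf' : f'.range = ⊤ := by
      -- Orthonormality of the gradients makes this combination a preimage of `c`.
      refine LinearMap.range_eq_top.2 fun c => ⟨∑ i, c i • ∇ (S.ρ i) x, ?_⟩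
      funext j
      change fderiv ℝ (S.ρ j) x _ = c j
      rw [← inner_gradient_eq_fderiv]
      exact (S.orthonormal x ⟨x.2, hx⟩).inner_right_fintype c j
    have hfx : f x = 0 := funext fun j => hzero x ⟨x.2, hx⟩ j
    have hker : v ∈ f'.ker := by
      rw [LinearMap.mem_ker]
      funext j
      exact hv j
    -- `φ` parametrizes the level set of `f` through `x` by the kernel of `f'`, with the inclusion
    -- as derivative at `0`; so `t ↦ φ (t v)` has velocity `v`.
    set φ := hf.implicitFunction f f' hf' (f x)
    have hφ : HasStrictFDerivAt φ f'.ker.subtypeL 0 := hf.to_implicitFunction hf'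
    set γ : ℝ → f'.ker := fun t => t • ⟨v, hker⟩
    have hγ : HasDerivAt γ ⟨v, hker⟩ 0 := by
      have h := (hasDerivAt_id (0 : ℝ)).smul_const (⟨v, hker⟩ : f'.ker)
      rw [one_smul] at h
      exact h
    have hγ0 : γ 0 = 0 := zero_smul _ _
    have hc : HasDerivAt (φ ∘ γ) v 0 := by
      have h := hφ.hasFDerivAt
      rw [← hγ0] at h
      exact h.comp_hasDerivAt 0 hγ
    have hx0 : (φ ∘ γ) 0 = x := by
      simp only [Function.comp, hγ0]
      exact hf.implicitFunction_apply_image hf'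
    have hmem : ∀ᶠ t in 𝓝 (0 : ℝ), (φ ∘ γ) t ∈ M := by
      have h1 : ∀ᶠ t in 𝓝 (0 : ℝ), (φ ∘ γ) t ∈ S.U := by
        refine hc.continuousAt.eventually (S.isOpen_U.mem_nhds ?_)
        rwa [hx0]
      have h2 : ∀ᶠ t in 𝓝 (0 : ℝ), f ((φ ∘ γ) t) = f x := by
        have ht : Tendsto (fun t => (f x, γ t)) (𝓝 0) (𝓝 (f x, (0 : f'.ker))) := by
          have := hγ.continuousAt.tendsto
          rw [hγ0] at this
          exact tendsto_const_nhds.prodMk_nhds this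
        exact ht.eventually (hf.map_implicitFunction_eq hf')
      filter_upwards [h1, h2] with t ht1 ht2
      have : (φ ∘ γ) t ∈ M ∩ S.U := by
        rw [S.inter_eq]
        exact ⟨ht1, fun j => (congrFun ht2 j).trans (congrFun hfx j)⟩
      exact this.1
    have := mem_tangentConeAt_of_hasDerivAt hc hmem
    rwa [hx0] at this

end

/-! ### Normalized defining functions by Gram-Schmidt. -/

section

/-- On the zero set, function coefficients behave like constants under differentiation; so
Gram-Schmidt on the gradients can be carried out on the functions themselves. -/
theorem fderiv_mul_of_eq_zero {E : Type*} [NormedAddCommGroup E] [NormedSpace ℝ E] {a f : E → ℝ}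
    {y : E} (ha : DifferentiableAt ℝ a y) (hf : DifferentiableAt ℝ f y) (h0 : f y = 0) (v : E) :
    fderiv ℝ (fun z => a z * f z) y v = a y * fderiv ℝ f y v := by
  rw [fderiv_fun_mul ha hf]
  simp [h0]

section

variable {E : Type*} [NormedAddCommGroup E] [InnerProductSpace ℝ E] [CompleteSpace E]

/-- Gram-Schmidt process for the differentials of functions on their common zero set. -/
theorem exists_orthonormal_gradient {x : E} : ∀ {p : ℕ} {U : Set E} (_ : IsOpen U) (_ : x ∈ U)
    {ρ : Fin p → E → ℝ} (_ : ∀ j, ContDiffOn ℝ ∞ (ρ j) U) (_ : ∀ j, ρ j x = 0)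
    (_ : LinearIndependent ℝ (fun j => ∇ (ρ j) x)),
    ∃ U' ⊆ U, IsOpen U' ∧ x ∈ U' ∧ ∃ σ : Fin p → E → ℝ, (∀ j, ContDiffOn ℝ ∞ (σ j) U') ∧
      (∀ y ∈ U', (∀ j, σ j y = 0) ↔ ∀ j, ρ j y = 0) ∧
      (∀ y ∈ U', (∀ j, ρ j y = 0) → Orthonormal ℝ (fun j => ∇ (σ j) y)) ∧
      ∀ j, ∇ (σ j) x ∈ Submodule.span ℝ (Set.range fun j => ∇ (ρ j) x) := by
  intro p
  induction p with
  | zero =>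
    intro U hU hx ρ hρ _ _
    exact ⟨U, subset_rfl, hU, hx, ρ, hρ, fun _ _ => Iff.rfl,
      fun _ _ _ => ⟨fun j => j.elim0, fun j => j.elim0⟩, fun j => j.elim0⟩
  | succ p ih =>
    intro U hU hx ρ hρ hρx hind
    obtain ⟨hind', hlast⟩ := linearIndependent_finSucc'.1 hind
    obtain ⟨U', hU'U, hU', hx', σ, hσ, hzero, horth, hspan⟩ :=
      ih hU hx (ρ := fun j => ρ j.castSucc) (fun j => hρ _) (fun j => hρx _) hind'
    set r := ρ (Fin.last p)
    have hr : ContDiffOn ℝ ∞ r U' := (hρ _).mono hU'U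
    have hgr := contDiffOn_gradient hU' hr
    have hgσ := fun j => contDiffOn_gradient hU' (hσ j)
    set c : Fin p → E → ℝ := fun j y => inner ℝ (∇ (σ j) y) (∇ r y)
    have hc : ∀ j, ContDiffOn ℝ ∞ (c j) U' := fun j => (hgσ j).inner ℝ hgr
    set g : E → E := fun y => ∇ r y - ∑ j, c j y • ∇ (σ j) y
    have hg : ContDiffOn ℝ ∞ g U' :=
      hgr.sub (ContDiffOn.sum fun j _ => (hc j).smul (hgσ j))
    -- Independence at `x` is all that is needed: `g` stays nonzero on a smaller neighbourhood. The
    -- span clause of the induction serves to reach this contradiction.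
    have hgx : g x ≠ 0 := fun h0 => by
      apply hlast
      have : ∇ r x = ∑ j, c j x • ∇ (σ j) x := sub_eq_zero.1 h0
      change ∇ r x ∈ _
      rw [this]
      exact Submodule.sum_mem _ fun j _ => Submodule.smul_mem _ _ (hspan j)
    set U'' : Set E := U' ∩ g ⁻¹' {0}ᶜ
    have hU'' : IsOpen U'' := hg.continuousOn.isOpen_inter_preimage hU' isOpen_compl_singleton
    have hsub : U'' ⊆ U' := Set.inter_subset_left
    have hg0 : ∀ y ∈ U'', g y ≠ 0 := fun y hy => hy.2
    -- On the common zero set the gradient of `f` is `g`, the part of `∇ r` orthogonal to the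
    -- earlier gradients.
    set f : E → ℝ := fun y => r y - ∑ j, c j y * σ j y
    have hf : ContDiffOn ℝ ∞ f U' :=
      hr.sub (ContDiffOn.sum fun j _ => (hc j).mul (hσ j))
    set a : E → ℝ := fun y => ‖g y‖⁻¹
    have ha : ContDiffOn ℝ ∞ a U'' :=
      ((hg.mono hsub).norm ℝ hg0).inv fun y hy => norm_ne_zero_iff.2 (hg0 y hy)
    set τ : E → ℝ := fun y => a y * f y
    have hτ : ContDiffOn ℝ ∞ τ U'' := ha.mul (hf.mono hsub)
    have hgrad : ∀ y ∈ U'', (∀ j, ρ j y = 0) → ∇ τ y = a y • g y := by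
      intro y hy hy0
      have hσ0 := (hzero y (hsub hy)).2 fun j => hy0 _
      have hf0 : f y = 0 := by simp [f, hσ0, hy0, r]
      refine ext_inner_right ℝ fun v => ?_
      rw [inner_gradient_eq_fderiv, fderiv_mul_of_eq_zero
        (differentiableAt_of_contDiffOn hU'' ha hy)
        (differentiableAt_of_contDiffOn hU' hf (hsub hy)) hf0, inner_smul_left]
      congr 1
      have hd : ∀ j, DifferentiableAt ℝ (fun z => c j z * σ j z) y := fun j =>
        differentiableAt_of_contDiffOn hU' ((hc j).mul (hσ j)) (hsub hy)
      simp only [f]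
      rw [fderiv_fun_sub (differentiableAt_of_contDiffOn hU' hr (hsub hy))
        (DifferentiableAt.fun_sum fun j _ => hd j), fderiv_fun_sum fun j _ => hd j]
      simp only [g, sub_apply, sum_apply, inner_sub_left,
        sum_inner, inner_smul_left, inner_gradient_eq_fderiv]
      congr 1
      refine Finset.sum_congr rfl fun j _ => ?_
      exact fderiv_mul_of_eq_zero (differentiableAt_of_contDiffOn hU' (hc j) (hsub hy))
        (differentiableAt_of_contDiffOn hU' (hσ j) (hsub hy)) (hσ0 j) v
    have hx'' : x ∈ U'' := ⟨hx', hgx⟩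
    refine ⟨U'', hsub.trans hU'U, hU'', hx'', Fin.snoc σ τ, ?_, ?_, ?_, ?_⟩
    · intro j
      refine Fin.lastCases ?_ (fun j => ?_) j
      · simpa using hτ
      · simpa using (hσ j).mono hsub
    · intro y hy
      rw [Fin.forall_fin_succ', Fin.forall_fin_succ']
      simp only [Fin.snoc_castSucc, Fin.snoc_last]
      rw [hzero y (hsub hy)]
      refine and_congr_right fun h => ?_
      have hσ0 := (hzero y (hsub hy)).2 h
      have hf0 : f y = r y := by simp [f, hσ0]
      have ha0 : a y ≠ 0 := inv_ne_zero (norm_ne_zero_iff.2 (hg0 y hy))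
      simp [τ, hf0, ha0, r]
    · intro y hy hy0
      have hO := horth y (hsub hy) fun j => hy0 _
      have hgy := hgrad y hy hy0
      have hort : ∀ j, inner ℝ (∇ (σ j) y) (g y) = 0 := fun j => by
        simp only [g, inner_sub_right]
        rw [hO.inner_right_fintype (fun i => c i y) j]
        exact sub_self _
      have hnorm : ‖∇ τ y‖ = 1 := by
        rw [hgy, norm_smul, Real.norm_of_nonneg (by positivity : 0 ≤ a y)]
        exact inv_mul_cancel₀ (norm_ne_zero_iff.2 (hg0 y hy))
      constructor
      · intro j
        refine Fin.lastCases ?_ (fun j => ?_) j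
        · simpa using hnorm
        · simpa using hO.1 j
      · intro i j
        refine Fin.lastCases ?_ (fun i => ?_) i <;> refine Fin.lastCases ?_ (fun j => ?_) j
        · exact fun h => absurd rfl h
        · intro _
          simp only [Fin.snoc_castSucc, Fin.snoc_last]
          rw [hgy, real_inner_comm, inner_smul_right, hort, mul_zero]
        · intro _
          simp only [Fin.snoc_castSucc, Fin.snoc_last]
          rw [hgy, inner_smul_right, hort, mul_zero]
        · intro h
          simpa using hO.2 fun hij => h (congrArg _ hij)
    · have hle : ∀ j, ∇ (σ j) x ∈ Submodule.span ℝ (Set.range fun j => ∇ (ρ j) x) := fun j =>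
        Submodule.span_mono (by rintro _ ⟨i, rfl⟩; exact ⟨i.castSucc, rfl⟩) (hspan j)
      intro j
      refine Fin.lastCases ?_ (fun j => ?_) j
      · simp only [Fin.snoc_last, hgrad x hx'' hρx]
        refine Submodule.smul_mem _ _ (Submodule.sub_mem _ (Submodule.subset_span ⟨_, rfl⟩) ?_)
        exact Submodule.sum_mem _ fun j _ => Submodule.smul_mem _ _ (hle j)
      · simpa using hle j

end

variable {n p : ℕ} {M : Set (Euc n)}

theorem IsSubmanifold.exists_normalSystem (hM : IsSubmanifold p M) (x : M) :
    ∃ S : NormalSystem p M, (x : Euc n) ∈ S.U := by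
  obtain ⟨U, hU, hx, ρ, hρ, hMU, hind⟩ := hM x x.2
  have hρ0 : ∀ y ∈ M ∩ U, ∀ j, ρ j y = 0 := fun y hy => by
    rw [hMU] at hy
    exact hy.2
  obtain ⟨U', hU'U, hU', hx', σ, hσ, hzero, horth, -⟩ :=
    exists_orthonormal_gradient hU hx hρ (hρ0 x ⟨x.2, hx⟩) (hind x ⟨x.2, hx⟩)
  refine ⟨⟨U', σ, hU', hσ, ?_, fun y hy => horth y hy.2 (hρ0 y ⟨hy.1, hU'U hy.2⟩)⟩, hx'⟩
  ext y
  refine ⟨fun hy => ⟨hy.2, (hzero y hy.2).2 (hρ0 y ⟨hy.1, hU'U hy.2⟩)⟩, fun hy => ⟨?_, hy.1⟩⟩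
  have : y ∈ M ∩ U := by
    rw [hMU]
    exact ⟨hU'U hy.1, (hzero y hy.1).1 hy.2⟩
  exact this.1

end

/-! ### The tangential projection, and `D^#` as `d^#` of a pull-back. -/

section

namespace NormalSystem

variable {n p k : ℕ} {M : Set (Euc n)} (S : NormalSystem p M)

/-- The map `v ↦ v - ∑ ⟪ν_j, v⟫ ν_j`, which on `M` is the orthogonal projection on the tangent
space. -/
def proj (y : Euc n) : Euc n →L[ℝ] Euc n :=
  ContinuousLinearMap.id ℝ (Euc n) -
    ∑ j, (innerSL ℝ (∇ (S.ρ j) y)).smulRight (∇ (S.ρ j) y)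

theorem proj_apply (y v : Euc n) :
    S.proj y v = v - ∑ j, inner ℝ (∇ (S.ρ j) y) v • ∇ (S.ρ j) y := by
  rw [proj]
  simp only [sub_apply, sum_apply, ContinuousLinearMap.smulRight_apply, innerSL_apply_apply]
  rfl

theorem contDiffOn_grad (j : Fin p) : ContDiffOn ℝ ∞ (∇ (S.ρ j)) S.U :=
  contDiffOn_gradient S.isOpen_U (S.smooth j)

theorem contDiffOn_proj_apply {g : Euc n → Euc n} {W : Set (Euc n)} (hW : W ⊆ S.U)
    (hg : ContDiffOn ℝ ∞ g W) : ContDiffOn ℝ ∞ (fun y => S.proj y (g y)) W := by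
  simp only [proj_apply]
  exact hg.sub (ContDiffOn.sum fun j _ =>
    (((S.contDiffOn_grad j).mono hW).inner ℝ hg).smul ((S.contDiffOn_grad j).mono hW))

theorem contDiffOn_proj : ContDiffOn ℝ ∞ S.proj S.U :=
  contDiffOn_clm_apply.2 fun _ => S.contDiffOn_proj_apply subset_rfl contDiffOn_const

variable {S} in
theorem differentiableAt_proj {x : Euc n} (hx : x ∈ S.U) : DifferentiableAt ℝ S.proj x :=
  differentiableAt_of_contDiffOn S.isOpen_U S.contDiffOn_proj hx

theorem inner_proj_comm (y v w : Euc n) :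
    inner ℝ (S.proj y v) w = inner ℝ v (S.proj y w) := by
  simp only [proj_apply, inner_sub_left, inner_sub_right, sum_inner, inner_sum, inner_smul_left,
    inner_smul_right]
  congr 1
  refine Finset.sum_congr rfl fun j _ => ?_
  rw [real_inner_comm v]
  exact mul_comm _ _

variable {S} {x : M} (hx : (x : Euc n) ∈ S.U)

include hx

theorem inner_grad_of_mem {v : Euc n} (hv : v ∈ T M x) (j : Fin p) :
    inner ℝ (∇ (S.ρ j) x) v = 0 := (mem_T_iff S hx).1 hv j

theorem proj_mem (v : Euc n) : S.proj x v ∈ T M x := by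
  rw [mem_T_iff S hx]
  intro j
  rw [proj_apply, inner_sub_right,
    (S.orthonormal x ⟨x.2, hx⟩).inner_right_fintype (fun i => inner ℝ (∇ (S.ρ i) x) v) j, sub_self]

theorem proj_of_mem {v : Euc n} (hv : v ∈ T M x) : S.proj x v = v := by
  simp only [proj_apply, inner_grad_of_mem hx hv, zero_smul, Finset.sum_const_zero, sub_zero]

theorem inner_proj_of_mem (v : Euc n) {w : Euc n} (hw : w ∈ T M x) :
    inner ℝ (S.proj x v) w = inner ℝ v w := by
  rw [inner_proj_comm, proj_of_mem hx hw]

theorem inner_eq_hess (j : Fin p) (u v : Euc n) :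
    inner ℝ (fderiv ℝ (∇ (S.ρ j)) x u) v = fderiv ℝ (fderiv ℝ (S.ρ j)) x u v :=
  inner_fderiv_gradient S.isOpen_U (S.smooth j) hx u v

theorem hess_comm (j : Fin p) (u v : Euc n) :
    fderiv ℝ (fderiv ℝ (S.ρ j)) x u v = fderiv ℝ (fderiv ℝ (S.ρ j)) x v u :=
  fderiv_fderiv_comm S.isOpen_U (S.smooth j) hx u v

/-- In the product rule for `⟪n_j, v⟫ n_j` the terms with differentiated `n_j` outside the scalar
product drop out, since `⟪n_j, v⟫ = 0`. -/
theorem fderiv_proj_of_mem (u : Euc n) {v : Euc n} (hv : v ∈ T M x) :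
    fderiv ℝ S.proj x u v =
      -∑ j, fderiv ℝ (fderiv ℝ (S.ρ j)) x u v • ∇ (S.ρ j) x := by
  have hd := fun j => differentiableAt_of_contDiffOn S.isOpen_U (S.contDiffOn_grad j) hx
  have hi : ∀ j, DifferentiableAt ℝ (fun y => inner ℝ (∇ (S.ρ j) y) v) (x : Euc n) := fun j =>
    (hd j).inner ℝ (differentiableAt_const v)
  have h1 : fderiv ℝ S.proj x u v = fderiv ℝ (fun y => S.proj y v) x u := by
    rw [fderiv_clm_apply (differentiableAt_proj hx) (differentiableAt_const v)]
    simp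
  rw [h1]
  simp only [proj_apply]
  rw [fderiv_const_sub, fderiv_fun_sum fun j _ => (hi j).fun_smul (hd j), neg_apply, sum_apply]
  congr 1
  refine Finset.sum_congr rfl fun j _ => ?_
  rw [fderiv_fun_smul (hi j) (hd j)]
  have h2 : fderiv ℝ (fun y => inner ℝ (∇ (S.ρ j) y) v) (x : Euc n) u =
      fderiv ℝ (fderiv ℝ (S.ρ j)) x u v := by
    rw [fderiv_inner_apply ℝ (hd j) (differentiableAt_const v), ← inner_eq_hess hx]
    simp
  simp only [ContinuousLinearMap.smulRight_apply, h2,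
    inner_grad_of_mem hx hv, zero_smul, zero_add]

omit hx

variable (S)

/-- The map induced by `proj` on the superspace. -/
def superProj (y : Euc n) : (Euc n × Euc n) →L[ℝ] (Euc n × Euc n) :=
  (S.proj y).prodMap (S.proj y)

theorem contDiffOn_superProj : ContDiffOn ℝ ∞ S.superProj S.U :=
  contDiffOn_clm_apply.2 fun _ => (S.contDiffOn_proj_apply subset_rfl contDiffOn_const).prodMk
    (S.contDiffOn_proj_apply subset_rfl contDiffOn_const)

/-- The extension of the restriction of a form to `M_s` by means of the projections on the tangent
spaces. -/
def pull (α : Superform n k) : Superform n k := fun y =>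
  (α y).compContinuousLinearMap (S.superProj y)

theorem pull_apply (α : Superform n k) (y : Euc n) (v : Fin k → Euc n × Euc n) :
    S.pull α y v = α y (fun i => (S.proj y (v i).1, S.proj y (v i).2)) := rfl

theorem contDiffOn_pull {α : Superform n k} {W : Set (Euc n)} (hW : W ⊆ S.U)
    (hα : ContDiffOn ℝ ∞ α W) : ContDiffOn ℝ ∞ (S.pull α) W :=
  contDiffOn_form_iff.2 fun _ => contDiffOn_form_apply hα fun _ =>
    (S.contDiffOn_proj_apply hW contDiffOn_const).prodMk
      (S.contDiffOn_proj_apply hW contDiffOn_const)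

variable {S}

include hx

theorem superProj_of_mem {w : Euc n × Euc n} (h1 : w.1 ∈ T M x) (h2 : w.2 ∈ T M x) :
    S.superProj x w = w :=
  Prod.ext (proj_of_mem hx h1) (proj_of_mem hx h2)

theorem fderiv_superProj_apply (u : Euc n) (w : Euc n × Euc n) :
    fderiv ℝ S.superProj x u w = (fderiv ℝ S.proj x u w.1, fderiv ℝ S.proj x u w.2) := by
  have hd := differentiableAt_of_contDiffOn S.isOpen_U S.contDiffOn_superProj hx
  have hp := differentiableAt_proj hx
  have h1 : fderiv ℝ S.superProj x u w = fderiv ℝ (fun y => S.superProj y w) x u := by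
    rw [fderiv_clm_apply hd (differentiableAt_const w)]
    simp
  have h2 : ∀ v, HasFDerivAt (fun y => S.proj y v) ((fderiv ℝ S.proj x).flip v) (x : Euc n) :=
    fun v => by simpa using hp.hasFDerivAt.clm_apply (hasFDerivAt_const v _)
  rw [h1]
  exact congrFun (congrArg _ ((h2 w.1).prodMk (h2 w.2)).fderiv) u

/-- The derivatives are taken along the `ξ`-components, as in `d^#`. In the second component the two
Hessian terms cancel by symmetry; in the first they form `F_j`. -/
theorem fderiv_superProj_sub {u w : Euc n × Euc n} (hu1 : u.1 ∈ T M x) (hu2 : u.2 ∈ T M x)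
    (hw1 : w.1 ∈ T M x) (hw2 : w.2 ∈ T M x) :
    fderiv ℝ S.superProj x u.2 w - fderiv ℝ S.superProj x w.2 u =
      ∑ j, secondForm (S.ρ j) x ![u, w] • (∇ (S.ρ j) x, (0 : Euc n)) := by
  rw [fderiv_superProj_apply hx, fderiv_superProj_apply hx, fderiv_proj_of_mem hx _ hu1,
    fderiv_proj_of_mem hx _ hu2, fderiv_proj_of_mem hx _ hw1, fderiv_proj_of_mem hx _ hw2]
  simp only [secondForm_apply S.isOpen_U (S.smooth _) hx, Prod.mk_sub_mk]
  refine Prod.ext ?_ ?_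
  · rw [Prod.fst_sum]
    simp only [Prod.fst_sub, Prod.smul_fst, Matrix.cons_val_zero, Matrix.cons_val_one, sub_smul,
      Finset.sum_sub_distrib]
    simp only [hess_comm hx _ u.2 w.1, hess_comm hx _ w.2 u.1]
    abel
  · rw [Prod.snd_sum]
    simp only [Prod.smul_snd, smul_zero, Finset.sum_const_zero, hess_comm hx _ u.2 w.2, sub_self]

/-- The restriction of `D^# α` to `M_s` in terms of the restriction of `α`. -/
theorem restrict_DSharp {α : Superform n k} (hα : DifferentiableAt ℝ α x) :
    restrict M (S.DSharp α) x = restrict M (dSharp (S.pull α)) x := by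
  ext v
  change (dSharp α x + S.FSharp α x) (fun i => superIncl M x (v i)) =
    dSharp (S.pull α) x (fun i => superIncl M x (v i))
  set w : Fin (k + 1) → Euc n × Euc n := fun i => superIncl M x (v i)
  have hw1 : ∀ i, (w i).1 ∈ T M x := fun i => (v i).1.2
  have hw2 : ∀ i, (w i).2 ∈ T M x := fun i => (v i).2.2
  have hQ : ∀ i, S.superProj x (w i) = w i := fun i => superProj_of_mem hx (hw1 i) (hw2 i)
  have hd := differentiableAt_of_contDiffOn S.isOpen_U S.contDiffOn_superProj hx
  have h1 : fderiv ℝ (S.pull α) x = _ :=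
    fderiv_continuousAlternatingMapCompContinuousLinearMap hα hd
  rw [dSharp, dSharp, h1, ContinuousLinearMap.add_comp,
    ContinuousAlternatingMap.alternatizeUncurryFin_add]
  rw [ContinuousAlternatingMap.add_apply, ContinuousAlternatingMap.add_apply]
  congr 1
  -- The part in which `α` is differentiated: tangent vectors are fixed by the projection, so it is
  -- `d^#α`.
  · rw [ContinuousAlternatingMap.alternatizeUncurryFin_apply,
      ContinuousAlternatingMap.alternatizeUncurryFin_apply]
    refine Finset.sum_congr rfl fun i _ => ?_
    congr 1
    change _ = fderiv ℝ α x (w i).2 (fun j => S.superProj x (i.removeNth w j))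
    congr 1
    funext j
    exact (hQ _).symm
  -- The part in which the projection is differentiated must be `𝓕^#α`; in degree `0` both vanish.
  · rw [ContinuousLinearMap.comp_assoc]
    cases k with
    | zero =>
      rw [ContinuousAlternatingMap.fderivCompContinuousLinearMap_of_isEmpty, Pi.zero_apply,
        Pi.zero_apply, ContinuousLinearMap.zero_comp,
        ← ContinuousAlternatingMap.alternatizeUncurryFinCLM_apply, map_zero]
      simp [FSharp, contractThenWedge]
    | succ k =>
      rw [alternatizeUncurryFin_fderivComp_apply _ _ _ _ hQ, FSharp,
        ContinuousAlternatingMap.sum_apply]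
      simp only [contractThenWedge_succ_apply]
      rw [Finset.sum_comm]
      refine Finset.sum_congr rfl fun i _ => ?_
      rw [Finset.sum_comm]
      refine Finset.sum_congr rfl fun j _ => ?_
      rw [← Finset.mul_sum]
      congr 1
      change _ = (α x).curryLeft (fderiv ℝ S.superProj x (w i.castSucc).2 (w j.succ) -
        fderiv ℝ S.superProj x (w j.succ).2 (w i.castSucc)) _
      rw [fderiv_superProj_sub hx (hw1 _) (hw2 _) (hw1 _) (hw2 _), map_sum,
        ContinuousAlternatingMap.sum_apply]
      refine Finset.sum_congr rfl fun l _ => ?_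
      rw [map_smul]
      rfl

end NormalSystem

end

/-! ### `D^#` on forms on `M_s`: independence of choices, smoothness, bidegree. -/

section

variable {n p k : ℕ} {M : Set (Euc n)}

theorem differentiableAt_form_apply {V E : Type*} [NormedAddCommGroup V] [NormedSpace ℝ V]
    [NormedAddCommGroup E] [NormedSpace ℝ E] {β : E → SForm V k} {x : E}
    (h : DifferentiableAt ℝ β x) (v : Fin k → V × V) : DifferentiableAt ℝ (fun y => β y v) x :=
  (ContinuousAlternatingMap.apply ℝ (V × V) ℝ v).differentiableAt.comp x h

theorem differentiableAt_pull {S : NormalSystem p M} {α : Superform n k} {W : Set (Euc n)}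
    (hW : IsOpen W) (hα : ContDiffOn ℝ ∞ α W) {x : Euc n} (hx : x ∈ S.U) (hxW : x ∈ W) :
    DifferentiableAt ℝ (S.pull α) x :=
  differentiableAt_of_contDiffOn (S.isOpen_U.inter hW)
    (S.contDiffOn_pull Set.inter_subset_left (hα.mono Set.inter_subset_right)) ⟨hx, hxW⟩

theorem restrict_dSharp_apply (β : Superform n k) (x : M) (v : Fin (k + 1) → T M x × T M x) :
    restrict M (dSharp β) x v = ∑ i : Fin (k + 1), (-1 : ℝ) ^ (i : ℕ) *
      fderiv ℝ β x (v i).2 (fun j => superIncl M x (i.removeNth v j)) := by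
  change ContinuousAlternatingMap.alternatizeUncurryFin _ (fun i => superIncl M x (v i)) = _
  rw [ContinuousAlternatingMap.alternatizeUncurryFin_apply]
  refine Finset.sum_congr rfl fun i _ => ?_
  rw [zsmul_eq_mul]
  push_cast
  rfl

theorem restrict_dSharp_congr {β γ : Superform n k} {x : M} (hβ : DifferentiableAt ℝ β x)
    (hγ : DifferentiableAt ℝ γ x) {W : Set (Euc n)} (hW : IsOpen W) (hx : (x : Euc n) ∈ W)
    (h : ∀ y ∈ M ∩ W, β y = γ y) : restrict M (dSharp β) x = restrict M (dSharp γ) x := by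
  ext v
  rw [restrict_dSharp_apply, restrict_dSharp_apply]
  refine Finset.sum_congr rfl fun i _ => ?_
  rw [fderiv_eq_of_eventuallyEq_on hβ hγ hW hx h (v i).2.2]

theorem contDiffOn_dSharp {β : Superform n k} {W : Set (Euc n)} (hW : IsOpen W)
    (hβ : ContDiffOn ℝ ∞ β W) : ContDiffOn ℝ ∞ (dSharp β) W := by
  have h := hβ.fderiv_of_isOpen hW (m := ∞) (by simp)
  exact (ContinuousAlternatingMap.alternatizeUncurryFinCLM ℝ (Euc n × Euc n) ℝ).contDiff
    |>.comp_contDiffOn (h.clm_comp contDiffOn_const)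

/-- The projection of the superspace of `ℝⁿ` on the superspace of `M`. -/
def NormalSystem.toT (S : NormalSystem p M) {x : M} (hx : (x : Euc n) ∈ S.U)
    (w : Euc n × Euc n) : T M x × T M x :=
  (⟨S.proj x w.1, NormalSystem.proj_mem hx _⟩, ⟨S.proj x w.2, NormalSystem.proj_mem hx _⟩)

theorem IsExtension.pull_apply {a : SuperformOn M k} {W : Set (Euc n)} {α : Superform n k}
    (h : IsExtension a W α) {S : NormalSystem p M} {y : M} (hy : (y : Euc n) ∈ S.U)
    (hyW : (y : Euc n) ∈ W) (w : Fin k → Euc n × Euc n) :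
    S.pull α y w = a y (fun i => S.toT hy (w i)) := by
  rw [h.2 y hyW]
  rfl

/-- Both maps are self-adjoint, take values in `T M x` and fix it, so both are the orthogonal
projection. -/
theorem NormalSystem.proj_eq_proj {S S' : NormalSystem p M} {x : M} (hx : (x : Euc n) ∈ S.U)
    (hx' : (x : Euc n) ∈ S'.U) : S.proj x = S'.proj x := by
  ext1 v
  refine ext_inner_right ℝ fun w => ?_
  rw [← S'.proj_of_mem hx' (S.proj_mem hx v), S'.inner_proj_comm, S.inner_proj_of_mem hx _
    (S'.proj_mem hx' w), ← S'.inner_proj_comm]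

theorem IsExtension.pull_eq_pull {a : SuperformOn M k} {W W' : Set (Euc n)} {α α' : Superform n k}
    (h : IsExtension a W α) (h' : IsExtension a W' α') {S S' : NormalSystem p M} {y : Euc n}
    (hy : y ∈ M ∩ ((S.U ∩ W) ∩ (S'.U ∩ W'))) : S.pull α y = S'.pull α' y := by
  ext w
  obtain ⟨hyM, ⟨h1, h2⟩, h3, h4⟩ := hy
  lift y to M using hyM
  rw [h.pull_apply h1 h2, h'.pull_apply h3 h4]
  simp only [NormalSystem.toT, NormalSystem.proj_eq_proj h1 h3]

/-- The restriction of a system of normalized defining functions to a smaller open set. -/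
def NormalSystem.shrink (S : NormalSystem p M) {W : Set (Euc n)} (hW : IsOpen W) :
    NormalSystem p M where
  U := S.U ∩ W
  ρ := S.ρ
  isOpen_U := S.isOpen_U.inter hW
  smooth j := (S.smooth j).mono Set.inter_subset_left
  inter_eq := by
    rw [← Set.inter_assoc, S.inter_eq]
    ext y
    simp only [Set.mem_inter_iff, Set.mem_ofPred_eq]
    tauto
  orthonormal y hy := S.orthonormal y ⟨hy.1, hy.2.1⟩

theorem IsExtension.mono {a : SuperformOn M k} {W W' : Set (Euc n)} {α : Superform n k}
    (h : IsExtension a W α) (hW : W' ⊆ W) : IsExtension a W' α :=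
  ⟨h.1.mono hW, fun y hy => h.2 y (hW hy)⟩

/-- The system and extension picked in the definition of `DSharpOn` are replaced by arbitrary ones:
the two pull-backs agree on `M` near `x`, and the restricted `d^#` sees no more than that. -/
theorem IsExtension.DSharpOn_eq {a : SuperformOn M k} {W : Set (Euc n)} {α : Superform n k}
    (h : IsExtension a W α) (hW : IsOpen W) {S : NormalSystem p M} {x : M}
    (hx : (x : Euc n) ∈ S.U) (hxW : (x : Euc n) ∈ W) :
    DSharpOn p a x = restrict M (dSharp (S.pull α)) x := by
  have hex : ∃ A : NormalSystem p M × Superform n k, (x : Euc n) ∈ A.1.U ∧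
      IsExtension a A.1.U A.2 :=
    -- The definition asks for an extension on the whole domain of the system, hence the shrinking.
    ⟨(S.shrink hW, α), ⟨hx, hxW⟩, h.mono Set.inter_subset_right⟩
  rw [DSharpOn, dif_pos hex]
  obtain ⟨h1, h2⟩ := hex.choose_spec
  set B := hex.choose
  rw [NormalSystem.restrict_DSharp h1 (differentiableAt_of_contDiffOn B.1.isOpen_U h2.1 h1)]
  exact restrict_dSharp_congr (differentiableAt_pull B.1.isOpen_U h2.1 h1 h1)
    (differentiableAt_pull hW h.1 hx hxW)
    ((B.1.isOpen_U.inter B.1.isOpen_U).inter (S.isOpen_U.inter hW)) ⟨⟨h1, h1⟩, hx, hxW⟩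
    fun y hy => h2.pull_eq_pull h hy

theorem IsExtension.DSharpOn_eq_restrict_DSharp {a : SuperformOn M k} {α : Superform n k}
    {S : NormalSystem p M} (h : IsExtension a S.U α) {x : M} (hx : (x : Euc n) ∈ S.U) :
    DSharpOn p a x = restrict M (S.DSharp α) x := by
  rw [h.DSharpOn_eq S.isOpen_U hx hx,
    NormalSystem.restrict_DSharp hx (differentiableAt_of_contDiffOn S.isOpen_U h.1 hx)]

/-- Besides smoothness of `D^#a`, this gives the explicit extension with which `D^#` is applied a
second time. -/
theorem IsExtension.isExtension_DSharpOn {a : SuperformOn M k} {W : Set (Euc n)}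
    {α : Superform n k} (h : IsExtension a W α) (hW : IsOpen W) (S : NormalSystem p M) :
    IsExtension (DSharpOn p a) (S.U ∩ W) (dSharp (S.pull α)) :=
  ⟨contDiffOn_dSharp (S.isOpen_U.inter hW)
    (S.contDiffOn_pull Set.inter_subset_left (h.1.mono Set.inter_subset_right)),
    fun _ hy => h.DSharpOn_eq hW hy.1 hy.2⟩

theorem IsSmoothForm.DSharpOn (hM : IsSubmanifold p M) {a : SuperformOn M k}
    (ha : IsSmoothForm a) : IsSmoothForm (DSharpOn p a) := fun x => by
  obtain ⟨S, hS⟩ := hM.exists_normalSystem x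
  obtain ⟨W, hW, hxW, α, hα⟩ := ha x
  exact ⟨S.U ∩ W, S.isOpen_U.inter hW, ⟨hS, hxW⟩, _, hα.isExtension_DSharpOn hW S⟩

/-- The formula for `D^# a` on vectors. -/
theorem IsExtension.DSharpOn_apply {a : SuperformOn M k} {W : Set (Euc n)} {α : Superform n k}
    (h : IsExtension a W α) (hW : IsOpen W) {S : NormalSystem p M} {x : M}
    (hx : (x : Euc n) ∈ S.U) (hxW : (x : Euc n) ∈ W) (v : Fin (k + 1) → T M x × T M x) :
    DSharpOn p a x v = ∑ i : Fin (k + 1), (-1 : ℝ) ^ (i : ℕ) *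
      fderiv ℝ (S.pull α) x (v i).2 (fun j => superIncl M x (i.removeNth v j)) := by
  rw [h.DSharpOn_eq hW hx hxW, restrict_dSharp_apply]

theorem HasBidegree.DSharpOn (hM : IsSubmanifold p M) {r s : ℕ} {a : SuperformOn M k}
    (ha : IsSmoothForm a) (hb : ∀ x, HasBidegree r s (a x)) (x : M) :
    HasBidegree r (s + 1) (DSharpOn p a x) := by
  obtain ⟨S, hS⟩ := hM.exists_normalSystem x
  obtain ⟨W, hW, hxW, α, hα⟩ := ha x
  refine ⟨by rw [← (hb x).1]; ring, fun t v ht => ?_⟩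
  rw [hα.DSharpOn_apply hW hS hxW]
  refine Finset.sum_eq_zero fun i _ => ?_
  -- If position `i` holds an `x`-vector, the direction of differentiation is `0`. Otherwise
  -- removing `i` keeps the number of `x`-vectors, so the function being differentiated vanishes
  -- along `M` by the bidegree of `a`.
  by_cases hi : i ∈ t
  · simp [hi]
  · have hd := differentiableAt_pull hW hα.1 hS hxW
    rw [fderiv_form_apply hd, fderiv_eq_of_eventuallyEq_on (h := fun _ => (0 : ℝ))
      (differentiableAt_form_apply hd _)
      (differentiableAt_const _) (S.isOpen_U.inter hW) ⟨hS, hxW⟩ ?_ (Subtype.mem _)]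
    · simp
    · rintro y ⟨hyM, hyS, hyW⟩
      lift y to M using hyM
      set t' : Finset (Fin k) := Finset.univ.filter fun j => i.succAbove j ∈ t
      have ht' : t'.card = t.card := by
        rw [← Finset.card_map i.succAboveEmb (s := t')]
        congr 1
        ext l
        simp only [t', Finset.mem_map, Finset.mem_filter, Finset.mem_univ, true_and]
        refine ⟨?_, fun hl => ?_⟩
        · rintro ⟨j, hj, rfl⟩
          exact hj
        · obtain ⟨j, rfl⟩ := Fin.exists_succAbove_eq (show l ≠ i from fun h => hi (h ▸ hl))
          exact ⟨j, hl, rfl⟩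
      rw [hα.pull_apply hyS hyW]
      rw [← (hb y).2 t' (fun j => ⟨S.proj y (v (i.succAbove j)), S.proj_mem hyS _⟩)
        (by rwa [ht'])]
      congr 1
      funext j
      by_cases hj : i.succAbove j ∈ t <;>
        simp [t', hj, Fin.removeNth, NormalSystem.toT, superIncl]

end

/-! ### The Levi-Civita connection. -/

section

variable {n p k : ℕ} {M : Set (Euc n)}

theorem IsSubmanifold.exists_normalSystem_subset (hM : IsSubmanifold p M) (x : M)
    {W : Set (Euc n)} (hW : IsOpen W) (hx : (x : Euc n) ∈ W) :
    ∃ S : NormalSystem p M, (x : Euc n) ∈ S.U ∧ S.U ⊆ W := by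
  obtain ⟨S, hS⟩ := hM.exists_normalSystem x
  exact ⟨S.shrink hW, ⟨hS, hx⟩, Set.inter_subset_right⟩

/-- The map `g` is, on the open set `U`, a smooth extension of the vector field `X`. -/
def VField.HasExtension (X : VField M) (U : Set (Euc n)) (g : Euc n → Euc n) : Prop :=
  ContDiffOn ℝ ∞ g U ∧ ∀ y : M, (y : Euc n) ∈ U → (X y : Euc n) = g y

theorem VField.IsSmooth.exists_hasExtension {X : VField M} (hX : X.IsSmooth) (x : M) :
    ∃ U, IsOpen U ∧ (x : Euc n) ∈ U ∧ ∃ g, X.HasExtension U g := by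
  obtain ⟨U, hU, hx, g, hg, h⟩ := hX x
  exact ⟨U, hU, hx, g, hg, h⟩

theorem VField.HasExtension.mono {X : VField M} {U U' : Set (Euc n)} {g : Euc n → Euc n}
    (h : X.HasExtension U g) (hU : U' ⊆ U) : X.HasExtension U' g :=
  ⟨h.1.mono hU, fun y hy => h.2 y (hU hy)⟩

theorem exists_common_hasExtension (hM : IsSubmanifold p M) {ι : Type*} [Finite ι]
    (X : ι → VField M) (hX : ∀ i, (X i).IsSmooth) (x : M) {W : Set (Euc n)} (hW : IsOpen W)
    (hx : (x : Euc n) ∈ W) :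
    ∃ S : NormalSystem p M, (x : Euc n) ∈ S.U ∧ S.U ⊆ W ∧
      ∃ g : ι → Euc n → Euc n, ∀ i, (X i).HasExtension S.U (g i) := by
  choose U hU hxU g hg using fun i => (hX i).exists_hasExtension x
  obtain ⟨S, hS, hSU⟩ := hM.exists_normalSystem_subset x
    (hW.inter (isOpen_iInter_of_finite hU)) ⟨hx, Set.mem_iInter.2 hxU⟩
  exact ⟨S, hS, hSU.trans Set.inter_subset_left, g, fun i => (hg i).mono
    (hSU.trans (Set.inter_subset_right.trans (Set.iInter_subset U i)))⟩

theorem exists_common_hasExtension_two (hM : IsSubmanifold p M) {X Y : VField M}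
    (hX : X.IsSmooth) (hY : Y.IsSmooth) (x : M) :
    ∃ S : NormalSystem p M, (x : Euc n) ∈ S.U ∧ ∃ g h : Euc n → Euc n,
      X.HasExtension S.U g ∧ Y.HasExtension S.U h := by
  obtain ⟨S, hS, -, g, hg⟩ := exists_common_hasExtension hM ![X, Y]
    (by intro i; fin_cases i <;> assumption) x isOpen_univ trivial
  exact ⟨S, hS, g 0, g 1, hg 0, hg 1⟩

theorem inner_sharp {V : Type*} [NormedAddCommGroup V] [InnerProductSpace ℝ V]
    [FiniteDimensional ℝ V] (a : SForm V 1) (w : V) :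
    inner ℝ (sharp a) w = a (fun _ => (w, 0)) := by
  have : CompleteSpace V := FiniteDimensional.complete ℝ V
  exact InnerProductSpace.toDual_symm_apply

/-- Only the term differentiating along the first argument survives: the others have `ξ`-component
`0`. -/
theorem IsExtension.DSharpOn_vecCons {a : SuperformOn M k} {W : Set (Euc n)} {α : Superform n k}
    (h : IsExtension a W α) (hW : IsOpen W) {S : NormalSystem p M} {x : M}
    (hx : (x : Euc n) ∈ S.U) (hxW : (x : Euc n) ∈ W) (v : T M x) (w : Fin k → T M x) :
    (DSharpOn p a x).curryLeft (0, v) (fun i => (w i, 0)) =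
      fderiv ℝ (S.pull α) x v (fun i => ((w i : Euc n), (0 : Euc n))) := by
  change DSharpOn p a x (Matrix.vecCons (0, v) fun i => (w i, 0)) = _
  rw [h.DSharpOn_apply hW hx hxW, Fin.sum_univ_succ, Finset.sum_eq_zero]
  · simp [Fin.removeNth, superIncl]
  · intro i _
    simp

theorem VField.HasExtension.flat {X : VField M} {U : Set (Euc n)} {g : Euc n → Euc n}
    (h : X.HasExtension U g) :
    IsExtension (fun y => flat (X y)) U (fun y => Super.flat (g y)) := by
  refine ⟨contDiffOn_form_iff.2 fun v => h.1.inner ℝ contDiffOn_const, fun y hy => ?_⟩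
  rw [restrict, ← h.2 y hy]
  rfl

section

variable {S : NormalSystem p M} {x : M} (hx : (x : Euc n) ∈ S.U)

include hx

/-- Since `g` is tangent on `M`, the projection in the pull-back can be moved onto `g` and
disappears there; `w` need not be tangent, which the curvature computation uses with `w = n_j`. -/
theorem VField.HasExtension.fderiv_pull_flat {X : VField M} {g : Euc n → Euc n}
    (h : X.HasExtension S.U g) (v : T M x) (w : Fin 1 → Euc n × Euc n) :
    fderiv ℝ (S.pull fun y => Super.flat (g y)) x v w = inner ℝ (fderiv ℝ g x v) (w 0).1 := by
  have hg := differentiableAt_of_contDiffOn S.isOpen_U h.1 hx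
  have hd := differentiableAt_pull S.isOpen_U h.flat.1 hx hx
  have hi : DifferentiableAt ℝ (fun y => inner ℝ (g y) (w 0).1) (x : Euc n) :=
    hg.inner ℝ (differentiableAt_const _)
  rw [fderiv_form_apply hd, fderiv_eq_of_eventuallyEq_on (differentiableAt_form_apply hd _)
    hi S.isOpen_U hx ?_ v.2, fderiv_inner_apply ℝ hg (differentiableAt_const _)]
  · simp
  · rintro y ⟨hyM, hy⟩
    lift y to M using hyM
    change inner ℝ (g y) (S.proj y (w 0).1) = _
    rw [← S.inner_proj_comm, ← h.2 y hy, S.proj_of_mem hy (X y).2]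

theorem VField.HasExtension.connection_eq {X : VField M} {g : Euc n → Euc n}
    (h : X.HasExtension S.U g) (v : T M x) :
    connection p M X x v = ⟨S.proj x (fderiv ℝ g x v), S.proj_mem hx _⟩ := by
  refine ext_inner_right ℝ fun w => ?_
  rw [connection, inner_sharp, h.flat.DSharpOn_vecCons S.isOpen_U hx hx v (fun _ => w),
    h.fderiv_pull_flat hx]
  exact (S.inner_proj_of_mem hx _ w.2).symm

theorem VField.HasExtension.derivOn_eq {X : VField M} {g : Euc n → Euc n}
    (h : X.HasExtension S.U g) (v : T M x) : derivOn X.val x v = fderiv ℝ g x v :=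
  derivOn_apply (differentiableAt_of_contDiffOn S.isOpen_U h.1 hx) S.isOpen_U hx h.2 v

/-- Differentiate `⟪n_j, g⟫ = 0` along `M`. The result is the second fundamental form. -/
theorem inner_grad_fderiv {X : VField M} {g : Euc n → Euc n} (h : X.HasExtension S.U g)
    (v : T M x) (j : Fin p) : inner ℝ (∇ (S.ρ j) x) (fderiv ℝ g x v) =
      -fderiv ℝ (fderiv ℝ (S.ρ j)) x v (X x) := by
  have hg := differentiableAt_of_contDiffOn S.isOpen_U h.1 hx
  have hn := differentiableAt_of_contDiffOn S.isOpen_U (S.contDiffOn_grad j) hx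
  have h0 : fderiv ℝ (fun y => inner ℝ (∇ (S.ρ j) y) (g y)) (x : Euc n) (v : Euc n) = 0 := by
    rw [fderiv_eq_of_eventuallyEq_on (h := fun _ => (0 : ℝ)) (hn.inner ℝ hg)
      (differentiableAt_const _) S.isOpen_U hx ?_ v.2]
    · simp
    · rintro y ⟨hyM, hy⟩
      lift y to M using hyM
      rw [← h.2 y hy, S.inner_grad_of_mem hy (X y).2]
  rw [fderiv_inner_apply ℝ hn hg, S.inner_eq_hess hx, ← h.2 x hx] at h0
  linarith

/-- The normal components of the two derivatives are equal because Hessians are symmetric. -/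
theorem ambientBracket_mem {X Y : VField M} {g h : Euc n → Euc n} (hX : X.HasExtension S.U g)
    (hY : Y.HasExtension S.U h) : ambientBracket X Y x ∈ T M x := by
  rw [mem_T_iff S hx]
  intro j
  rw [ambientBracket, hX.derivOn_eq hx, hY.derivOn_eq hx, inner_sub_right,
    inner_grad_fderiv hx hX, inner_grad_fderiv hx hY, S.hess_comm hx]
  ring

end

theorem VField.HasExtension.connection {S : NormalSystem p M} {X Y : VField M} {g h : Euc n → Euc n}
    (hX : X.HasExtension S.U g) (hY : Y.HasExtension S.U h) :
    VField.HasExtension (fun x => Super.connection p M Y x (X x)) S.U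
      (fun y => S.proj y (fderiv ℝ h y (g y))) := by
  refine ⟨S.contDiffOn_proj_apply subset_rfl
    (contDiffOn_fderiv_apply S.isOpen_U hY.1 hX.1), fun y hy => ?_⟩
  change (Super.connection p M Y y (X y) : Euc n) = _
  rw [hY.connection_eq hy, hX.2 y hy]

theorem isLeviCivita_connection (hM : IsSubmanifold p M) : IsLeviCivita M (connection p M) where
  smooth X Y hX hY x := by
    obtain ⟨S, hS, g, h, hg, hh⟩ := exists_common_hasExtension_two hM hX hY x
    exact ⟨S.U, S.isOpen_U, hS, _, hg.connection hh⟩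
  add_vector Y hY x v w := by
    obtain ⟨S, hS, g, -, hg, -⟩ := exists_common_hasExtension_two hM hY hY x
    ext1
    simp [hg.connection_eq hS]
  smul_vector Y hY x c v := by
    obtain ⟨S, hS, g, -, hg, -⟩ := exists_common_hasExtension_two hM hY hY x
    ext1
    simp [hg.connection_eq hS]
  add_field Y Z hY hZ x v := by
    obtain ⟨S, hS, g, h, hg, hh⟩ := exists_common_hasExtension_two hM hY hZ x
    have hgh : VField.HasExtension (Y + Z) S.U (g + h) := ⟨hg.1.add hh.1, fun y hy => by
      change (Y y : Euc n) + Z y = g y + h y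
      rw [hg.2 y hy, hh.2 y hy]⟩
    ext1
    rw [hgh.connection_eq hS, hg.connection_eq hS, hh.connection_eq hS,
      fderiv_add (differentiableAt_of_contDiffOn S.isOpen_U hg.1 hS)
        (differentiableAt_of_contDiffOn S.isOpen_U hh.1 hS)]
    simp
  leibniz f Y hf hY x v := by
    obtain ⟨W, hW, hxW, φ, hφ, hfφ⟩ := hf x
    obtain ⟨S, hS, hSW, g, hg⟩ := exists_common_hasExtension hM (fun _ : Unit => Y)
      (fun _ => hY) x hW hxW
    replace hg := hg ()
    set g := g ()
    have hφ' := hφ.mono hSW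
    have hfg : VField.HasExtension (fun y => f y • Y y) S.U (fun y => φ y • g y) :=
      ⟨hφ'.smul hg.1, fun y hy => by
        change f y • (Y y : Euc n) = _
        rw [hg.2 y hy, hfφ y (hSW hy)]⟩
    have hdφ := differentiableAt_of_contDiffOn S.isOpen_U hφ' hS
    ext1
    rw [hfg.connection_eq hS, hg.connection_eq hS,
      derivOn_apply hdφ S.isOpen_U hS (fun y hy => hfφ y (hSW hy)),
      fderiv_fun_smul hdφ (differentiableAt_of_contDiffOn S.isOpen_U hg.1 hS)]
    change S.proj x (φ x • fderiv ℝ g x v + fderiv ℝ φ x v • g x) =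
      f x • S.proj x (fderiv ℝ g x v) + fderiv ℝ φ x v • (Y x : Euc n)
    rw [map_add, map_smul, map_smul, ← hg.2 x hS, S.proj_of_mem hS (Y x).2, hfφ x (hSW hS)]
  metric Y Z hY hZ x v := by
    obtain ⟨S, hS, g, h, hg, hh⟩ := exists_common_hasExtension_two hM hY hZ x
    have hdg := differentiableAt_of_contDiffOn S.isOpen_U hg.1 hS
    have hdh := differentiableAt_of_contDiffOn S.isOpen_U hh.1 hS
    rw [derivOn_apply (g := fun y => inner ℝ (g y) (h y)) (hdg.inner ℝ hdh) S.isOpen_U hS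
      (fun y hy => by rw [← hg.2 y hy, ← hh.2 y hy]; rfl), fderiv_inner_apply ℝ hdg hdh,
      hg.connection_eq hS, hh.connection_eq hS, ← hg.2 x hS, ← hh.2 x hS]
    change _ = inner ℝ (S.proj x (fderiv ℝ g x v)) (Z x : Euc n) +
      inner ℝ (Y x : Euc n) (S.proj x (fderiv ℝ h x v))
    rw [S.inner_proj_of_mem hS _ (Z x).2, ← S.inner_proj_comm, S.proj_of_mem hS (Y x).2]
    ring
  torsion_free X Y hX hY x := by
    obtain ⟨S, hS, g, h, hg, hh⟩ := exists_common_hasExtension_two hM hX hY x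
    have hb := S.proj_of_mem hS (ambientBracket_mem hS hg hh)
    rw [← hb, ambientBracket, hg.derivOn_eq hS, hh.derivOn_eq hS, map_sub,
      hg.connection_eq hS, hh.connection_eq hS]
    rfl

/-- This is the product rule for `Π^*α` evaluated on the extended fields. Where a field is
differentiated, the projection inside `Π^*α` turns its derivative into `∇_v X_i`. -/
theorem DSharpOn_eq_covariantDerivative (hM : IsSubmanifold p M) {r : ℕ} {a : SuperformOn M r}
    (ha : IsSmoothForm a) (X : Fin r → VField M) (hX : ∀ i, (X i).IsSmooth) (x : M)
    (v : T M x) :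
    (DSharpOn p a x).curryLeft (0, v) (fun i => (X i x, 0)) =
      derivOn (fun y => a y (fun i => (X i y, 0))) x v -
        ∑ i, a x (fun j => (if j = i then connection p M (X i) x v else X j x, 0)) := by
  obtain ⟨W, hW, hxW, α, hα'⟩ := ha x
  obtain ⟨S, hS, hSW, g, hg⟩ := exists_common_hasExtension hM X hX x hW hxW
  have hα := hα'.mono hSW
  have hdα := differentiableAt_pull S.isOpen_U hα.1 hS hS
  have hdg : ∀ i, HasFDerivAt (fun y => (g i y, (0 : Euc n)))
      ((fderiv ℝ (g i) x).prod (0 : Euc n →L[ℝ] Euc n)) (x : Euc n) := fun i =>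
    (differentiableAt_of_contDiffOn S.isOpen_U (hg i).1 hS).hasFDerivAt.prodMk
      (hasFDerivAt_const _ _)
  have hG := hdα.hasFDerivAt.continuousAlternatingMap_apply hdg
  have hext : ∀ y : M, (y : Euc n) ∈ S.U → a y (fun i => (X i y, 0)) =
      S.pull α y (fun i => (g i y, (0 : Euc n))) := fun y hy => by
    rw [hα.pull_apply hy hy]
    congr 1
    funext i
    refine Prod.ext (Subtype.ext ?_) (Subtype.ext ?_)
    · change (X i y : Euc n) = S.proj y (g i y)
      rw [← (hg i).2 y hy, S.proj_of_mem hy (X i y).2]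
    · exact (map_zero (S.proj y)).symm
  rw [hα.DSharpOn_vecCons S.isOpen_U hS hS,
    derivOn_apply hG.differentiableAt S.isOpen_U hS hext, hG.fderiv, add_apply, sum_apply,
    eq_sub_iff_add_eq]
  congr 1
  · change _ = fderiv ℝ (S.pull α) x v (fun i => (g i x, (0 : Euc n)))
    simp only [(hg _).2 x hS]
  · refine Finset.sum_congr rfl fun i _ => ?_
    change _ = S.pull α x (Function.update (fun i => (g i x, (0 : Euc n))) i
      (fderiv ℝ (g i) x v, 0))
    rw [hα.pull_apply hS hS]
    congr 1
    funext j
    by_cases hj : j = i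
    · subst hj
      rw [Function.update_self, if_pos rfl, (hg j).connection_eq hS]
      exact Prod.ext rfl (Subtype.ext (map_zero (S.proj x)).symm)
    · rw [Function.update_of_ne hj, if_neg hj]
      refine Prod.ext (Subtype.ext ?_) (Subtype.ext (map_zero (S.proj x)).symm)
      change (X j x : Euc n) = S.proj x (g j x)
      rw [← (hg j).2 x hS, S.proj_of_mem hS (X j x).2]

end

section

variable {n p k : ℕ} {M : Set (Euc n)}

/-! ### The curvature form -/

theorem NormalSystem.curvatureForm_apply (S : NormalSystem p M) (y : Euc n)
    (a b c e : Euc n × Euc n) : S.curvatureForm y ![a, b, c, e] =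
      ∑ j, (secondForm (S.ρ j) y ![a, b] * secondForm (S.ρ j) y ![c, e] -
        secondForm (S.ρ j) y ![a, c] * secondForm (S.ρ j) y ![b, e] +
        secondForm (S.ρ j) y ![a, e] * secondForm (S.ρ j) y ![b, c]) := by
  rw [curvatureForm, ContinuousAlternatingMap.smul_apply, ContinuousAlternatingMap.sum_apply,
    Finset.smul_sum]
  refine Finset.sum_congr rfl fun j _ => ?_
  rw [wedge_self_apply, smul_eq_mul]
  ring

theorem eta_fin_four {E : Type*} (v : Fin 4 → E) : v = ![v 0, v 1, v 2, v 3] := by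
  funext i
  fin_cases i <;> rfl

theorem restrict_curvatureForm_apply (S : NormalSystem p M) (x : M)
    (v : Fin 4 → T M x × T M x) : restrict M S.curvatureForm x v =
      S.curvatureForm x ![superIncl M x (v 0), superIncl M x (v 1), superIncl M x (v 2),
        superIncl M x (v 3)] := by
  change S.curvatureForm x (fun i => superIncl M x (v i)) = _
  rw [eta_fin_four fun i => superIncl M x (v i)]

theorem NormalSystem.contDiffOn_curvatureForm (S : NormalSystem p M) :
    ContDiffOn ℝ ∞ S.curvatureForm S.U := by
  refine contDiffOn_form_iff.2 fun v => ?_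
  have h := fun j u => contDiffOn_form_iff.1 (contDiffOn_secondForm S.isOpen_U (S.smooth j)) u
  rw [eta_fin_four v]
  simp only [curvatureForm_apply]
  exact ContDiffOn.sum fun j _ => (((h j _).mul (h j _)).sub ((h j _).mul (h j _))).add
    ((h j _).mul (h j _))

theorem NormalSystem.fderiv_proj_eq {S S' : NormalSystem p M} {x : M} (hx : (x : Euc n) ∈ S.U)
    (hx' : (x : Euc n) ∈ S'.U) {u : Euc n} (hu : u ∈ T M x) :
    fderiv ℝ S.proj x u = fderiv ℝ S'.proj x u := by
  refine fderiv_eq_of_eventuallyEq_on (differentiableAt_proj hx) (differentiableAt_proj hx')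
    (S.isOpen_U.inter S'.isOpen_U) ⟨hx, hx'⟩ ?_ hu
  rintro y ⟨hyM, hy, hy'⟩
  lift y to M using hyM
  exact proj_eq_proj hy hy'

theorem NormalSystem.sum_secondForm_smul {S : NormalSystem p M} {x : M} (hx : (x : Euc n) ∈ S.U)
    (u w : T M x × T M x) :
    ∑ j, secondForm (S.ρ j) x ![superIncl M x u, superIncl M x w] • ∇ (S.ρ j) x =
      fderiv ℝ S.proj x (u.2 : Euc n) w.1 - fderiv ℝ S.proj x (w.2 : Euc n) u.1 := by
  have h := congrArg Prod.fst (fderiv_superProj_sub hx (u := superIncl M x u)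
    (w := superIncl M x w) u.1.2 u.2.2 w.1.2 w.2.2)
  rw [fderiv_superProj_apply hx, fderiv_superProj_apply hx, Prod.fst_sub, Prod.fst_sum] at h
  exact h.symm

/-- By orthonormality the left side is the scalar product of two vectors `∑ F_j n_j`, and these are
tangential derivatives of the projection, independent of the system. Hence so is the restriction of
`R`. -/
theorem NormalSystem.sum_secondForm_mul {S : NormalSystem p M} {x : M} (hx : (x : Euc n) ∈ S.U)
    (u w u' w' : T M x × T M x) :
    ∑ j, secondForm (S.ρ j) x ![superIncl M x u, superIncl M x w] *
        secondForm (S.ρ j) x ![superIncl M x u', superIncl M x w'] =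
      inner ℝ (fderiv ℝ S.proj x (u.2 : Euc n) w.1 - fderiv ℝ S.proj x (w.2 : Euc n) u.1)
        (fderiv ℝ S.proj x (u'.2 : Euc n) w'.1 - fderiv ℝ S.proj x (w'.2 : Euc n) u'.1) := by
  rw [← sum_secondForm_smul hx, ← sum_secondForm_smul hx,
    (S.orthonormal x ⟨x.2, hx⟩).inner_sum]
  rfl

theorem NormalSystem.restrict_curvatureForm_eq {S S' : NormalSystem p M} {x : M}
    (hx : (x : Euc n) ∈ S.U) (hx' : (x : Euc n) ∈ S'.U) :
    restrict M S.curvatureForm x = restrict M S'.curvatureForm x := by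
  ext v
  simp only [restrict_curvatureForm_apply, curvatureForm_apply, Finset.sum_add_distrib,
    Finset.sum_sub_distrib, sum_secondForm_mul hx, sum_secondForm_mul hx',
    fderiv_proj_eq hx hx' (Subtype.mem _)]

theorem NormalSystem.hasBidegree_curvatureForm {S : NormalSystem p M} {x : M}
    (hx : (x : Euc n) ∈ S.U) : HasBidegree 2 2 (restrict M S.curvatureForm x) := by
  refine ⟨rfl, fun s v hs => ?_⟩
  have h1 : ∀ (j : Fin p) (a b : T M x),
      secondForm (S.ρ j) x ![superIncl M x (a, 0), superIncl M x (b, 0)] = 0 := fun j a b => by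
    rw [secondForm_apply S.isOpen_U (S.smooth j) hx]
    simp [superIncl]
  have h2 : ∀ (j : Fin p) (a b : T M x),
      secondForm (S.ρ j) x ![superIncl M x (0, a), superIncl M x (0, b)] = 0 := fun j a b => by
    rw [secondForm_apply S.isOpen_U (S.smooth j) hx]
    simp [superIncl]
  have hcard : s.card = ∑ i : Fin 4, if i ∈ s then 1 else 0 := by simp
  rw [hcard, Fin.sum_univ_four] at hs
  rw [restrict_curvatureForm_apply, curvatureForm_apply]
  refine Finset.sum_eq_zero fun j _ => ?_
  -- Unless exactly two vectors are `x`-vectors, each of the three pairings of the four positions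
  -- contains a pair of equal type, on which the `(1,1)`-form `F_j` vanishes.
  by_cases c0 : (0 : Fin 4) ∈ s <;> by_cases c1 : (1 : Fin 4) ∈ s <;>
    by_cases c2 : (2 : Fin 4) ∈ s <;> by_cases c3 : (3 : Fin 4) ∈ s <;>
    simp only [c0, c1, c2, c3, if_true, if_false, h1, h2, mul_zero, zero_mul, sub_zero,
      add_zero] <;> simp [c0, c1, c2, c3] at hs

theorem NormalSystem.isSymmetric_curvatureForm {S : NormalSystem p M} {x : M}
    (hx : (x : Euc n) ∈ S.U) : IsSymmetric (restrict M S.curvatureForm x) := by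
  have hF : ∀ (j : Fin p) (u w : T M x × T M x), secondForm (S.ρ j) x
      ![superIncl M x (u.2, -u.1), superIncl M x (w.2, -w.1)] =
      secondForm (S.ρ j) x ![superIncl M x u, superIncl M x w] := fun j u w => by
    rw [secondForm_apply S.isOpen_U (S.smooth j) hx, secondForm_apply S.isOpen_U (S.smooth j) hx]
    simp [superIncl, hess_comm hx j u.2, hess_comm hx j w.2]
    ring
  ext v
  change restrict M S.curvatureForm x (fun i => ((v i).2, -(v i).1)) = _
  simp only [restrict_curvatureForm_apply, curvatureForm_apply, hF]

/-- Reading the coefficients as functions of the second variable makes `d^#` an ordinary exterior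
derivative on `ℝⁿ × ℝⁿ`, so `(d^#)² = 0` is inherited from it. -/
theorem extDeriv_comp_snd {β : Superform n k} {z : Euc n × Euc n}
    (hβ : DifferentiableAt ℝ β z.2) :
    extDeriv (fun z : Euc n × Euc n => β z.2) z = dSharp β z.2 := by
  have h : HasFDerivAt (fun z : Euc n × Euc n => β z.2)
      (fderiv ℝ β z.2 ∘L ContinuousLinearMap.snd ℝ (Euc n) (Euc n)) z :=
    hβ.hasFDerivAt.comp z hasFDerivAt_snd
  rw [extDeriv, h.fderiv, dSharp]

theorem dSharp_dSharp {β : Superform n k} {W : Set (Euc n)} (hW : IsOpen W)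
    (hβ : ContDiffOn ℝ ∞ β W) {x : Euc n} (hx : x ∈ W) : dSharp (dSharp β) x = 0 := by
  have hz : ContDiffAt ℝ ∞ (fun z : Euc n × Euc n => β z.2) (0, x) :=
    (hβ.contDiffAt (hW.mem_nhds hx)).comp (0, x) contDiffAt_snd
  have h1 : extDeriv (fun z : Euc n × Euc n => β z.2) =ᶠ[𝓝 ((0 : Euc n), x)]
      fun z => dSharp β z.2 := by
    filter_upwards [continuous_snd.continuousAt.eventually (hW.mem_nhds hx)] with z hz
    exact extDeriv_comp_snd (differentiableAt_of_contDiffOn hW hβ hz)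
  rw [← extDeriv_comp_snd (z := (0, x))
    (differentiableAt_of_contDiffOn hW (contDiffOn_dSharp hW hβ) hx), ← h1.extDeriv_eq]
  exact extDeriv_extDeriv_apply hz
    (by simpa using WithTop.coe_le_coe.2 (le_top (a := (2 : ℕ∞))))

theorem secondForm_inl {S : NormalSystem p M} {x : M} (hx : (x : Euc n) ∈ S.U) (j : Fin p)
    (a : Euc n) (w : Euc n × Euc n) : secondForm (S.ρ j) x ![(a, 0), w] =
      fderiv ℝ (fderiv ℝ (S.ρ j)) x a w.2 := by
  rw [secondForm_apply S.isOpen_U (S.smooth j) hx]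
  simp

theorem flat_sharp {V : Type*} [NormedAddCommGroup V] [InnerProductSpace ℝ V]
    [FiniteDimensional ℝ V] {a : SForm V 1} (ha : HasBidegree 1 0 a) : flat (sharp a) = a := by
  ext v
  change inner ℝ (sharp a) (v 0).1 = a v
  rw [inner_sharp]
  have h0 : a (fun _ => (0, (v 0).2)) = 0 := by
    simpa using ha.2 ∅ (fun _ => (v 0).2) (by simp)
  have hv : v = Function.update v 0 ((((v 0).1, 0) : V × V) + (0, (v 0).2)) := by
    funext i
    rw [Subsingleton.elim i 0]
    simp
  conv_rhs => rw [hv]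
  rw [ContinuousAlternatingMap.map_update_add]
  have hu : ∀ w : V × V, Function.update v 0 w = fun _ => w := fun w => by
    funext i
    rw [Subsingleton.elim i 0, Function.update_self]
  rw [hu, hu, h0, add_zero]

theorem IsSmoothForm.isSmooth_sharp (hM : IsSubmanifold p M) {a : SuperformOn M 1}
    (ha : IsSmoothForm a) : VField.IsSmooth (fun y => sharp (a y)) := fun x => by
  obtain ⟨W, hW, hxW, α, hα⟩ := ha x
  obtain ⟨S, hS⟩ := hM.exists_normalSystem x
  have hβ := S.contDiffOn_pull (W := S.U ∩ W) Set.inter_subset_left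
    (hα.1.mono Set.inter_subset_right)
  -- The pull-back is needed: the vector dual to `α` itself may have a normal component on `M`, the
  -- one dual to the pull-back has none.
  refine ⟨S.U ∩ W, S.isOpen_U.inter hW, ⟨hS, hxW⟩, fun y => sharp (S.pull α y), ?_, ?_⟩
  · have h : ContDiffOn ℝ ∞ (fun y => InnerProductSpace.toDual ℝ (Euc n) (sharp (S.pull α y)))
        (S.U ∩ W) := contDiffOn_clm_apply.2 fun w => by
      simp only [InnerProductSpace.toDual_apply_apply, inner_sharp]
      exact contDiffOn_form_iff.1 hβ _
    have h' := (InnerProductSpace.toDual ℝ (Euc n)).symm.toContinuousLinearEquiv.contDiff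
      |>.comp_contDiffOn h
    exact h'.congr fun y _ => ((InnerProductSpace.toDual ℝ (Euc n)).symm_apply_apply _).symm
  · rintro y ⟨hyS, hyW⟩
    refine ext_inner_right ℝ fun w => ?_
    rw [inner_sharp, hα.pull_apply hyS hyW]
    have : (fun _ : Fin 1 => S.toT hyS (w, 0)) =
        fun _ => ((⟨S.proj y w, S.proj_mem hyS w⟩ : T M y), (0 : T M y)) := by
      funext _
      exact Prod.ext rfl (Subtype.ext (map_zero (S.proj y)))
    rw [this, ← inner_sharp]
    change inner ℝ ((sharp (a y) : T M y) : Euc n) w =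
      inner ℝ ((sharp (a y) : T M y) : Euc n) (S.proj y w)
    rw [← S.inner_proj_comm, S.proj_of_mem hyS (sharp (a y)).2]

theorem DSharpOn_DSharpOn (hM : IsSubmanifold p M) {a : SuperformOn M 1} (ha : IsSmoothForm a)
    (hb : ∀ x, HasBidegree 1 0 (a x)) {S : NormalSystem p M} {x : M} (hx : (x : Euc n) ∈ S.U) :
    DSharpOn p (DSharpOn p a) x = contract (k := 3) (a x) (restrict M S.curvatureForm x) := by
  set X : VField M := fun y => sharp (a y)
  have hX : X.IsSmooth := ha.isSmooth_sharp hM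
  have haX : a = fun y => flat (X y) := funext fun y => (flat_sharp (hb y)).symm
  obtain ⟨S', hS', hSS', g', hg'⟩ := exists_common_hasExtension hM (fun _ : Unit => X)
    (fun _ => hX) x isOpen_univ trivial
  rw [NormalSystem.restrict_curvatureForm_eq hx hS']
  clear hx hSS' S
  rename' S' => S, hS' => hx
  have hg := hg' ()
  set g := g' ()
  set β := S.pull fun y => flat (g y)
  have hβ : ContDiffOn ℝ ∞ β S.U := S.contDiffOn_pull subset_rfl hg.flat.1
  have hγ : IsExtension (DSharpOn p a) S.U (dSharp β) := by
    have h := hg.flat.isExtension_DSharpOn S.isOpen_U S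
    rw [Set.inter_self, ← haX] at h
    exact h
  rw [hγ.DSharpOn_eq_restrict_DSharp hx]
  -- The contraction of `d^#β` with `n_j`. As `(n_j, 0)` has no `ξ`-part, only differentiation along
  -- `w` remains; it produces the normal component of the derivative of `g`, and the two minus signs
  -- cancel.
  have hγN : ∀ (j : Fin p) (w : T M x × T M x),
      dSharp β x ![(∇ (S.ρ j) x, 0), superIncl M x w] =
        fderiv ℝ (fderiv ℝ (S.ρ j)) x (X x) (w.2 : Euc n) := fun j w => by
    rw [dSharp, ContinuousAlternatingMap.alternatizeUncurryFin_apply, Fin.sum_univ_two]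
    have h1 := hg.fderiv_pull_flat hx w.2 ((1 : Fin 2).removeNth
      ![(∇ (S.ρ j) x, 0), superIncl M x w])
    have h2 := inner_grad_fderiv hx hg w.2 j
    rw [real_inner_comm] at h2
    rw [S.hess_comm hx, ← neg_eq_iff_eq_neg.2 h2]
    simp only [ContinuousLinearMap.comp_apply]
    change _ + (-1) ^ 1 • fderiv ℝ β x w.2 _ = _
    rw [h1]
    simp [Fin.removeNth]
  ext v
  have hL : restrict M (S.DSharp (dSharp β)) x v =
      S.FSharp (dSharp β) x (fun i => superIncl M x (v i)) := by
    change (dSharp (dSharp β) x + S.FSharp (dSharp β) x) (fun i => superIncl M x (v i)) = _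
    rw [dSharp_dSharp S.isOpen_U hβ hx, zero_add]
  have hR : contract (k := 3) (a x) (restrict M S.curvatureForm x) v = S.curvatureForm x
      ![((X x : Euc n), 0), superIncl M x (v 0), superIncl M x (v 1), superIncl M x (v 2)] := by
    change restrict M S.curvatureForm x (Matrix.vecCons (X x, 0) v) = _
    rw [restrict_curvatureForm_apply]
    rfl
  rw [hL, hR, S.curvatureForm_apply, NormalSystem.FSharp, ContinuousAlternatingMap.sum_apply]
  refine Finset.sum_congr rfl fun j _ => ?_
  simp only [secondForm_inl hx]
  rw [contractThenWedge_succ_apply, Fin.sum_univ_two]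
  have hI0 : Finset.Ici (0 : Fin 2) = {0, 1} := by decide
  have hI1 : Finset.Ici (1 : Fin 2) = {1} := by decide
  rw [hI0, hI1, Finset.sum_pair (by decide), Finset.sum_singleton]
  set w : Fin 3 → Euc n × Euc n := fun i => superIncl M x (v i)
  have e00 : Matrix.vecCons (∇ (S.ρ j) (x : Euc n), (0 : Euc n))
      ((0 : Fin 2).removeNth ((Fin.castSucc (0 : Fin 2)).removeNth w)) =
      ![(∇ (S.ρ j) x, 0), superIncl M x (v 2)] := by
    funext i; fin_cases i <;> rfl
  have e01 : Matrix.vecCons (∇ (S.ρ j) (x : Euc n), (0 : Euc n))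
      ((1 : Fin 2).removeNth ((Fin.castSucc (0 : Fin 2)).removeNth w)) =
      ![(∇ (S.ρ j) x, 0), superIncl M x (v 1)] := by
    funext i; fin_cases i <;> rfl
  have e11 : Matrix.vecCons (∇ (S.ρ j) (x : Euc n), (0 : Euc n))
      ((1 : Fin 2).removeNth ((Fin.castSucc (1 : Fin 2)).removeNth w)) =
      ![(∇ (S.ρ j) x, 0), superIncl M x (v 0)] := by
    funext i; fin_cases i <;> rfl
  rw [e00, e01, e11, hγN, hγN, hγN]
  have s2 : ∀ u : T M x × T M x, (superIncl M x u).2 = u.2 := fun _ => rfl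
  simp only [s2]
  norm_num
  ring

/-! ### Gauss's formula -/

/-- The derivative of a family of self-adjoint maps is self-adjoint. -/
theorem NormalSystem.inner_fderiv_proj {S : NormalSystem p M} {x : M} (hx : (x : Euc n) ∈ S.U)
    (u q w : Euc n) : inner ℝ (fderiv ℝ S.proj x u q) w = inner ℝ q (fderiv ℝ S.proj x u w) := by
  have hd := differentiableAt_proj hx
  have hv : ∀ v : Euc n,
      HasFDerivAt (fun y => S.proj y v) ((fderiv ℝ S.proj x).flip v) (x : Euc n) :=
    fun v => by simpa using hd.hasFDerivAt.clm_apply (hasFDerivAt_const v _)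
  have h1 := congrArg (fun L => L u) (((hv q).inner ℝ (hasFDerivAt_const w (x : Euc n))).fderiv)
  have h2 := congrArg (fun L => L u) (((hasFDerivAt_const q (x : Euc n)).inner ℝ (hv w)).fderiv)
  simp only [S.inner_proj_comm] at h1
  simpa using h1.symm.trans h2

theorem gauss_formula (hM : IsSubmanifold p M) {V W X Y : VField M} (hV : V.IsSmooth)
    (hW : W.IsSmooth) (hX : X.IsSmooth) {S : NormalSystem p M} {x : M} (hx : (x : Euc n) ∈ S.U) :
    restrict M S.curvatureForm x ![(X x, 0), (Y x, 0), (0, V x), (0, W x)] =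
      inner ℝ (riemann (connection p M) V W X x) (Y x) := by
  obtain ⟨S', hS', -, g, hg⟩ := exists_common_hasExtension hM ![V, W, X]
    (by intro i; fin_cases i <;> assumption) x isOpen_univ trivial
  rw [NormalSystem.restrict_curvatureForm_eq hx hS']
  clear hx S
  rename' S' => S, hS' => hx
  have hgV : V.HasExtension S.U (g 0) := hg 0
  have hgW : W.HasExtension S.U (g 1) := hg 1
  have hgX : X.HasExtension S.U (g 2) := hg 2
  have hd2X := differentiableAt_of_contDiffOn S.isOpen_U
    (hgX.1.fderiv_of_isOpen S.isOpen_U (m := ∞) (by simp)) hx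
  -- The product rule for `Π(dg Z)`, paired with tangent `Y`. Under exchange of `V` and `W` the
  -- second derivatives of `g` cancel, and the terms `dg(dh v)` match the bracket term; the Hessian
  -- products remain.
  have key : ∀ {Z : VField M} {h : Euc n → Euc n} (_ : Z.HasExtension S.U h) (v : T M x),
      inner ℝ (connection p M (fun y => connection p M X y (Z y)) x v) (Y x) =
        ∑ j, fderiv ℝ (fderiv ℝ (S.ρ j)) x v (Y x) * fderiv ℝ (fderiv ℝ (S.ρ j)) x (Z x) (X x) +
        inner ℝ (fderiv ℝ (fderiv ℝ (g 2)) x v (Z x)) (Y x : Euc n) +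
        inner ℝ (fderiv ℝ (g 2) x (fderiv ℝ h x v)) (Y x : Euc n) := by
    intro Z h hZ v
    have hdZ := differentiableAt_of_contDiffOn S.isOpen_U hZ.1 hx
    rw [(hZ.connection hgX).connection_eq hx]
    change inner ℝ (S.proj x _) (Y x : Euc n) = _
    rw [S.inner_proj_of_mem hx _ (Y x).2, fderiv_clm_apply (NormalSystem.differentiableAt_proj hx)
      (hd2X.clm_apply hdZ), fderiv_clm_apply hd2X hdZ]
    simp only [add_apply, ContinuousLinearMap.comp_apply, ContinuousLinearMap.flip_apply,
      inner_add_left, map_add]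
    -- `dg Z` need not be tangent, so the derivative of the projection is moved onto `Y`, where
    -- `fderiv_proj_of_mem` applies.
    rw [S.inner_fderiv_proj hx, S.inner_proj_of_mem hx _ (Y x).2,
      S.inner_proj_of_mem hx _ (Y x).2, S.fderiv_proj_of_mem hx _ (Y x).2, ← hZ.2 x hx]
    have hs : inner ℝ (fderiv ℝ (g 2) x (Z x)) (-∑ j, fderiv ℝ (fderiv ℝ (S.ρ j)) x v (Y x) •
        ∇ (S.ρ j) (x : Euc n)) = ∑ j, fderiv ℝ (fderiv ℝ (S.ρ j)) x v (Y x) *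
          fderiv ℝ (fderiv ℝ (S.ρ j)) x (Z x) (X x) := by
      rw [inner_neg_right, inner_sum, ← Finset.sum_neg_distrib]
      refine Finset.sum_congr rfl fun j _ => ?_
      rw [inner_smul_right, real_inner_comm, inner_grad_fderiv hx hgX]
      ring
    rw [hs]
    ring
  have hbr : (bracket V W x : Euc n) = fderiv ℝ (g 1) x (V x) - fderiv ℝ (g 0) x (W x) := by
    have hmem := ambientBracket_mem hx hgV hgW
    have h := (T M x).orthogonalProjectionOnto_mem_subspace_eq_self ⟨_, hmem⟩
    rw [bracket, h]
    change ambientBracket V W x = _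
    rw [ambientBracket, hgV.derivOn_eq hx, hgW.derivOn_eq hx]
  have hlast : inner ℝ (connection p M X x (bracket V W x)) (Y x) =
      inner ℝ (fderiv ℝ (g 2) x (fderiv ℝ (g 1) x (V x))) (Y x : Euc n) -
      inner ℝ (fderiv ℝ (g 2) x (fderiv ℝ (g 0) x (W x))) (Y x : Euc n) := by
    rw [hgX.connection_eq hx]
    change inner ℝ (S.proj x _) (Y x : Euc n) = _
    rw [S.inner_proj_of_mem hx _ (Y x).2, hbr, map_sub, inner_sub_left]
  rw [riemann, inner_sub_left, inner_sub_left, key hgW, key hgV, hlast,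
    fderiv_fderiv_comm S.isOpen_U hgX.1 hx (W x : Euc n) (V x)]
  rw [restrict_curvatureForm_apply, S.curvatureForm_apply]
  have hX0 : ∀ u : T M x, superIncl M x (u, 0) = ((u : Euc n), (0 : Euc n)) := fun _ => rfl
  have hV0 : ∀ u : T M x, superIncl M x (0, u) = ((0 : Euc n), (u : Euc n)) := fun _ => rfl
  simp only [Matrix.cons_val, hX0, hV0, secondForm_inl hx, S.hess_comm hx _ (X x : Euc n),
    S.hess_comm hx _ (Y x : Euc n), Finset.sum_add_distrib, Finset.sum_sub_distrib]
  -- `F_j` vanishes on the pair `(X, 0)`, `(Y, 0)`, so one of the three pairings in `R` drops out.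
  simp only [map_zero, zero_apply, zero_mul, Finset.sum_const_zero]
  simp only [mul_comm (fderiv ℝ (fderiv ℝ (S.ρ _)) (x : Euc n) (W x) (X x)),
    mul_comm (fderiv ℝ (fderiv ℝ (S.ρ _)) (x : Euc n) (V x) (X x))]
  ring

end

end Super

end

open Super in
theorem mainTheorem8 (n p : ℕ) (M : Set (Euc n)) (hM : IsSubmanifold p M) :
    -- normalized local defining functions exist, and `D^#` is well defined on forms on `M_s`
    (∀ x : M, ∃ S : NormalSystem p M, (x : Euc n) ∈ S.U) ∧
    (∀ (k : ℕ) (a : SuperformOn M k) (S : NormalSystem p M) (α : Superform n k),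
      IsExtension a S.U α → ∀ x : M, (x : Euc n) ∈ S.U →
        DSharpOn p a x = restrict M (S.DSharp α) x) ∧
    (∀ (k : ℕ) (a : SuperformOn M k), IsSmoothForm a → IsSmoothForm (DSharpOn p a)) ∧
    (∀ (k r s : ℕ) (a : SuperformOn M k), IsSmoothForm a → (∀ x, HasBidegree r s (a x)) →
      ∀ x, HasBidegree r (s + 1) (DSharpOn p a x)) ∧
    -- `D^#` is the Levi-Civita connection of `M`: on vector fields, and on `(r,0)`-forms
    IsLeviCivita M (connection p M) ∧
    (∀ (r : ℕ) (a : SuperformOn M r), IsSmoothForm a → (∀ x, HasBidegree r 0 (a x)) →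
      ∀ X : Fin r → VField M, (∀ i, (X i).IsSmooth) → ∀ (x : M) (v : T M x),
        (DSharpOn p a x).curryLeft (0, v) (fun i => (X i x, 0)) =
          derivOn (fun y => a y (fun i => (X i y, 0))) x v -
            ∑ i, a x (fun j => (if j = i then connection p M (X i) x v else X j x, 0))) ∧
    -- its curvature is the symmetric `(2,2)`-form `R = (1/2) ∑ F_j ∧ F_j`
    ∃ R : SuperformOn M 4, IsSmoothForm R ∧
      (∀ x, HasBidegree 2 2 (R x)) ∧ (∀ x, IsSymmetric (R x)) ∧
      (∀ (S : NormalSystem p M) (x : M), (x : Euc n) ∈ S.U →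
        R x = restrict M S.curvatureForm x) ∧
      (∀ a : SuperformOn M 1, IsSmoothForm a → (∀ x, HasBidegree 1 0 (a x)) →
        ∀ x, DSharpOn p (DSharpOn p a) x = contract (k := 3) (a x) (R x)) ∧
      (∀ V W X Y : VField M, V.IsSmooth → W.IsSmooth → X.IsSmooth → Y.IsSmooth → ∀ x : M,
        R x ![(X x, 0), (Y x, 0), (0, V x), (0, W x)] =
          inner ℝ (riemann (connection p M) V W X x) (Y x)) := by
  refine ⟨hM.exists_normalSystem, fun k a S α h x hx => h.DSharpOn_eq_restrict_DSharp hx,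
    fun k a ha => ha.DSharpOn hM, fun k r s a ha hb x => HasBidegree.DSharpOn hM ha hb x,
    isLeviCivita_connection hM,
    fun r a ha _ X hX x v => DSharpOn_eq_covariantDerivative hM ha X hX x v, ?_⟩
  choose S hS using hM.exists_normalSystem
  have hR : ∀ (S' : NormalSystem p M) (x : M), (x : Euc n) ∈ S'.U →
      restrict M (S x).curvatureForm x = restrict M S'.curvatureForm x :=
    fun S' x hx => NormalSystem.restrict_curvatureForm_eq (hS x) hx
  refine ⟨fun x => restrict M (S x).curvatureForm x, fun x => ?_,
    fun x => NormalSystem.hasBidegree_curvatureForm (hS x),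
    fun x => NormalSystem.isSymmetric_curvatureForm (hS x), hR,
    fun a ha hb x => DSharpOn_DSharpOn hM ha hb (hS x),
    fun V W X Y hV hW hX _ x => gauss_formula hM hV hW hX (hS x)⟩
  -- `R` uses a separately chosen system at each point; near `x` all of them give the restriction of
  -- the one form belonging to `S x`.
  exact ⟨(S x).U, (S x).isOpen_U, hS x, _, (S x).contDiffOn_curvatureForm,
    fun y hy => hR (S x) y hy⟩
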